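/- **Theorem (set-indexed 0-1 law).** *Setting.* Let $\mathcal T$ be a set and let $\mathcal A$ be an indexing collection on $\mathcal T$, i.e. a collection of subsets of $\mathcal T$ with the following properties. (1) $\varnothing\in\mathcal A$, and $\mathcal A$ and $\mathcal A\setminus\{\varnothing\}$ are closed under countable intersections. (2) There is an increasing sequence of finite subcollections $\mathcal A_n\subseteq\mathcal A$, closed under intersections, such that $A=\bigcap_n g_n(A)$ for every $A\in\mathcal A$, where $g_n(A)$ is the intersection of all $A'\in\mathcal A_n\cup\{\mathcal T\}$ with $A\subseteq A'$. (3) If $A,A_1,\dots,A_n\in\mathcal A$ ($n\ge1$) and $A\subseteq\bigcup_iA_i$, then $A\subseteq A_j$ for some $j$. (4) The map $t\mapsto A(t)=\bigcap_nA_n(t)$, where $A_n(t)$ is the intersection of all $A'\in\mathcal A_n\cup\{\mathcal T\}$ with $t\in A'$, is a bijection from $\mathcal T$ onto $\mathcal A\setminus\{\varnothing\}$. Write $\mathcal C$ for the class of sets $A\setminus\bigcup_{i\le n}A_i$ with $n\ge 0$ and $A,A_1,\dots,A_n\in\mathcal A$. A pseudo-metric $d$ on $\mathcal A$ is called compatible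 if: $d(A\cap A'',A'\cap A'')\le d(A,A')$ for all $A,A',A''\in\mathcal A$; $d(A_n,\bigcap_kA_k)\to0$ for every non-increasing sequence $(A_n)$ in $\mathcal A$; the largest diameter, for the pseudo-metric $(s,s')\mapsto d(A(s),A(s'))$ on $\mathcal T$, of a set $A\setminus\bigcup\{A'\in\mathcal A_n:A'\subsetneq A\}$ with $A\in\mathcal A_n$ tends to $0$ as $n\to\infty$; and for all $A\subseteq A'$ in $\mathcal A$ there is $A''\in\mathcal A$ with $A\subseteq A''\subseteq A'$ and $d(A,A'')=d(A'',A')=d(A,A')/2$. Let $d_{\mathcal A}$ be a compatible pseudo-metric on $\mathcal A$, and let $m$ be a measure on $\sigma(\mathcal A)$ with $m(A)<\infty$ for all $A\in\mathcal A$ such that $d_m(A,A')=m(A\triangle A')$ is also compatible. Let $X=(X_A)_{A\in\mathcal A}$ be a real square-integrable set-indexed Lévy process on a probability space $(\Omega,\mathcal F,\mathbb P)$: $X_\varnothing=0$; $\mathbb E[X_A^2]<\infty$ for all $A\in\mathcal A$; and, with $\Delta X$ the additive extension of $X$ to finite unions of sets of $\mathcal C$, (i) $\Delta X_{C_1},\dots,\Delta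 X_{C_n}$ are independent whenever $C_1,\dots,C_n\in\mathcal C$ are pairwise disjoint, (ii) $\Delta X_{C_1}$ and $\Delta X_{C_2}$ have the same law whenever $C_1,C_2\in\mathcal C$ and $m(C_1)=m(C_2)$, (iii) $X_{A_n}\to X_{\bigcap_k A_k}$ in distribution for every non-increasing sequence $(A_n)$ in $\mathcal A$. Let $\kappa_1\in\mathbb R$ and $\kappa_2\ge0$ be the constants (taken to be $0$ if $m=0$) with $\mathbb E[\Delta X_C]=\kappa_1m(C)$ and $\operatorname{Var}(\Delta X_C)=\kappa_2m(C)$ for $C\in\mathcal C$; in terms of the Lévy–Khintchine triplet $(b,\sigma^2,\nu)$ of $X$, $\kappa_1=b+\int_{|x|>1}x\,\nu(dx)$ and $\kappa_2=\sigma^2+\int x^2\,\nu(dx)$. Let $L(X)$ be the space of measurable $g:\mathcal T\to\mathbb R$ with $$\|g\|_{L(X)}=\big(\kappa_1^2\|g\|_{L^1(m)}^2+\kappa_2\|g\|_{L^2(m)}^2\big)^{1/2}<\infty\qquad(0\cdot\infty=0),$$ and let $g\mapsto\int g\,dX$ be the continuous linear map $L(X)\to L^2(\Omega)$ with $\int\mathbf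 1_A\,dX=X_A$ for all $A\in\mathcal A$, i.e. the extension by density from the linear span of $\{\mathbf 1_A:A\in\mathcal A\}$. Let $f:\mathcal T\to\mathbb R$ be measurable with $f\mathbf 1_A\in L(X)$ for all $A\in\mathcal A$, and for each $A\in\mathcal A$ let $Y_A$ be any version of $\int f\mathbf 1_A\,dX$. *Statement.* Let $A\in\mathcal A$. For $\rho>0$ put $$\mathcal V(A,\rho)=\bigcup_{A'\in\mathcal A,\ d_{\mathcal A}(A,A')<\rho}(A\triangle A'),\qquad \mathcal F_{(A,\rho)}=\sigma\big(Y_A-Y_{A'}:A'\in\mathcal A,\ 0<d_{\mathcal A}(A,A')<\rho\big),$$ and $\mathcal F_{A+}=\bigcap_{\rho>0}\mathcal F_{(A,\rho)}$. If $m(\mathcal V(A,\rho))\to0$ as $\rho\to0^+$, then every event in $\mathcal F_{A+}$ has probability $0$ or $1$. -/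

import Mathlib

open MeasureTheory ProbabilityTheory Filter Topology
open scoped ENNReal symmDiff

namespace SetIndexed

/-! ### Indexing collections -/

section Collections

variable {T : Type*}

/-- `hull 𝒟 S` is the intersection of all members of `𝒟 ∪ {T}` that contain `S`. With `𝒟 = 𝒜ₙ`
it is `gₙ(A)` for `S = A`, and `Aₙ(t)` for `S = {t}`. -/
def hull (𝒟 : Set (Set T)) (S : Set T) : Set T :=
  ⋂₀ {B | B ∈ insert Set.univ 𝒟 ∧ S ⊆ B}

/-- `A(t) = ⋂ₙ Aₙ(t)`. -/
def tipSet (mesh : ℕ → Set (Set T)) (t : T) : Set T :=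
  ⋂ n, hull (mesh n) {t}

/-- `𝒜` is an indexing collection on `T`, with approximating finite subcollections
`𝒜ₙ = mesh n`. -/
structure IsIndexingCollection (𝒜 : Set (Set T)) (mesh : ℕ → Set (Set T)) : Prop where
  empty_mem : ∅ ∈ 𝒜
  iInter_mem : ∀ A : ℕ → Set T, (∀ n, A n ∈ 𝒜) → ⋂ n, A n ∈ 𝒜
  iInter_mem_diff : ∀ A : ℕ → Set T, (∀ n, A n ∈ 𝒜 \ {∅}) → ⋂ n, A n ∈ 𝒜 \ {∅}
  mesh_subset : ∀ n, mesh n ⊆ 𝒜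
  mesh_finite : ∀ n, (mesh n).Finite
  mesh_mono : Monotone mesh
  mesh_inter : ∀ n, ∀ A ∈ mesh n, ∀ B ∈ mesh n, A ∩ B ∈ mesh n
  /-- Separability from above. -/
  eq_iInter_hull : ∀ A ∈ 𝒜, A = ⋂ n, hull (mesh n) A
  /-- The SHAPE condition. -/
  shape : ∀ A ∈ 𝒜, ∀ s : Finset (Set T), s.Nonempty → (∀ B ∈ s, B ∈ 𝒜) →
    A ⊆ ⋃ B ∈ s, B → ∃ B ∈ s, A ⊆ B
  /-- The TIP assumption. -/
  tip : Set.BijOn (tipSet mesh) Set.univ (𝒜 \ {∅})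

/-- The class `𝒞` of increment sets `A \ (A₁ ∪ ⋯ ∪ Aₙ)`. -/
def incrementClass (𝒜 : Set (Set T)) : Set (Set T) :=
  {C | ∃ A ∈ 𝒜, ∃ s : Finset (Set T), (∀ B ∈ s, B ∈ 𝒜) ∧ C = A \ ⋃ B ∈ s, B}

/-- The left neighbourhoods `𝒞ˡ(𝒟)`: the sets `A \ ⋃ {A' ∈ 𝒟 : A' ⊊ A}` with `A ∈ 𝒟`. -/
def leftNeighborhoods (𝒟 : Set (Set T)) : Set (Set T) :=
  {C | ∃ A ∈ 𝒟, C = A \ ⋃₀ {A' | A' ∈ 𝒟 ∧ A' ⊂ A}}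

/-- `d` is a (set-indexed) compatible pseudo-metric on `𝒜`. Values of `d` outside `𝒜` are
irrelevant. -/
structure IsCompatibleMetric (𝒜 : Set (Set T)) (mesh : ℕ → Set (Set T))
    (d : Set T → Set T → ℝ) : Prop where
  self : ∀ A ∈ 𝒜, d A A = 0
  symm : ∀ A ∈ 𝒜, ∀ B ∈ 𝒜, d A B = d B A
  triangle : ∀ A ∈ 𝒜, ∀ B ∈ 𝒜, ∀ C ∈ 𝒜, d A C ≤ d A B + d B C
  contractive : ∀ A ∈ 𝒜, ∀ A' ∈ 𝒜, ∀ A'' ∈ 𝒜, d (A ∩ A'') (A' ∩ A'') ≤ d A A'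
  outer_continuous : ∀ A : ℕ → Set T, (∀ n, A n ∈ 𝒜) → Antitone A →
    Tendsto (fun n => d (A n) (⋂ k, A k)) atTop (𝓝 0)
  /-- The largest diameter of a left neighbourhood in `𝒞ˡ(𝒜ₙ)`, for the pseudo-metric
  `(s, s') ↦ d (A(s)) (A(s'))`, tends to `0`. -/
  shrinking_mesh : ∀ ε : ℝ, 0 < ε → ∃ N : ℕ, ∀ n ≥ N, ∀ C ∈ leftNeighborhoods (mesh n),
    ∀ s ∈ C, ∀ s' ∈ C, d (tipSet mesh s) (tipSet mesh s') ≤ ε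
  midpoint : ∀ A ∈ 𝒜, ∀ A' ∈ 𝒜, A ⊆ A' → ∃ A'' ∈ 𝒜, A ⊆ A'' ∧ A'' ⊆ A' ∧
    d A A'' = d A A' / 2 ∧ d A'' A' = d A A' / 2

/-- The vicinity of `A` of size `ρ`: the union of the sets `A ∆ A'` over `A'` in the open ball
of radius `ρ` around `A`. -/
def vicinity (𝒜 : Set (Set T)) (d : Set T → Set T → ℝ) (A : Set T) (ρ : ℝ) : Set T :=
  ⋃ A' ∈ {A' | A' ∈ 𝒜 ∧ d A A' < ρ}, A ∆ A'

/-! ### Simple functions and the linear extension of a map on `𝒜` -/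

/-- The indicator function of `U`, as a real function. -/
noncomputable def ind (U : Set T) : T → ℝ := U.indicator 1

/-- The space `ℰ` of simple functions, spanned by the indicators of the members of `𝒜`. -/
def simpleFunctions (𝒜 : Set (Set T)) : Submodule ℝ (T → ℝ) :=
  Submodule.span ℝ (ind '' 𝒜)

theorem linearIndependent_ind {𝒜 : Set (Set T)} {mesh : ℕ → Set (Set T)}
    (h𝒜 : IsIndexingCollection 𝒜 mesh) :
    LinearIndependent ℝ (fun A : {A : Set T // A ∈ 𝒜 \ {∅}} => ind (A : Set T)) := by
  classical
  rw [linearIndependent_iff']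
  intro s c hc
  by_contra hne
  push Not at hne
  obtain ⟨i₀, hi₀, hci₀⟩ := hne
  set u := s.filter (fun i => c i ≠ 0) with hu
  have hu0 : u.Nonempty := ⟨i₀, by simp [hu, hi₀, hci₀]⟩
  obtain ⟨M, hM⟩ := u.exists_maximal hu0
  have hMu : M ∈ u := hM.prop
  have hcM : c M ≠ 0 := (Finset.mem_filter.mp hMu).2
  have hsum : ∀ t, ∑ i ∈ u, c i * ind (i : Set T) t = 0 := by
    intro t
    have h1 := congrFun hc t
    simp only [Finset.sum_apply, Pi.smul_apply, smul_eq_mul, Pi.zero_apply] at h1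
    rw [← h1, hu, Finset.sum_filter]
    refine Finset.sum_congr rfl fun i _ => ?_
    by_cases hi : c i = 0 <;> simp [hi]
  have hcov : (M : Set T) ⊆ ⋃ B ∈ (u.erase M).image Subtype.val, B := by
    intro t ht
    by_contra hnot
    simp only [Set.mem_iUnion, Finset.mem_image, not_exists] at hnot
    have h2 := hsum t
    rw [Finset.sum_eq_single M] at h2
    · simp [ind, ht, hcM] at h2
    · intro b hb hbM
      have hbt : t ∉ (b : Set T) := fun hbt =>
        hnot b ⟨b, Finset.mem_erase.mpr ⟨hbM, hb⟩, rfl⟩ hbt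
      simp [ind, hbt]
    · exact fun h => absurd hMu h
  have hMne : (M : Set T).Nonempty := Set.nonempty_iff_ne_empty.mpr M.2.2
  have hne' : ((u.erase M).image Subtype.val).Nonempty := by
    obtain ⟨t, ht⟩ := hMne
    have := hcov ht
    simp only [Set.mem_iUnion] at this
    obtain ⟨B, hB, _⟩ := this
    exact ⟨B, hB⟩
  obtain ⟨B, hB, hMB⟩ := h𝒜.shape M M.2.1 _ hne' (by
    intro B hB
    obtain ⟨b, _, rfl⟩ := Finset.mem_image.mp hB
    exact b.2.1) hcov
  obtain ⟨b, hb, rfl⟩ := Finset.mem_image.mp hB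
  obtain ⟨hbM, hbu⟩ := Finset.mem_erase.mp hb
  have hle : M ≤ b := hMB
  exact hbM (le_antisymm (hM.le_of_ge hbu hle) hle)

/-- Every map `h` on an indexing collection with `h ∅ = 0` is induced by a linear functional. -/
theorem exists_linearExtension {𝒜 : Set (Set T)} {mesh : ℕ → Set (Set T)}
    (h𝒜 : IsIndexingCollection 𝒜 mesh) (h : Set T → ℝ) (h0 : h ∅ = 0) :
    ∃ L : (T → ℝ) →ₗ[ℝ] ℝ, ∀ A ∈ 𝒜, L (ind A) = h A := by
  have hli := linearIndependent_ind h𝒜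
  obtain ⟨L, hL⟩ := LinearMap.exists_extend
    ((Finsupp.linearCombination ℝ (fun A : {A : Set T // A ∈ 𝒜 \ {∅}} => h A)).comp
      (hli.repr : _ →ₗ[ℝ] _))
  refine ⟨L, fun A hA => ?_⟩
  by_cases hA0 : A = ∅
  · subst hA0
    have : ind (∅ : Set T) = 0 := by ext t; simp [ind]
    rw [this, map_zero, h0]
  · let i : {A : Set T // A ∈ 𝒜 \ {∅}} := ⟨A, hA, hA0⟩
    have hmem : ind A ∈ Submodule.span ℝ
        (Set.range (fun A : {A : Set T // A ∈ 𝒜 \ {∅}} => ind (A : Set T))) :=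
      Submodule.subset_span ⟨i, rfl⟩
    have h1 := LinearMap.congr_fun hL ⟨ind A, hmem⟩
    simp only [LinearMap.comp_apply, Submodule.subtype_apply] at h1
    rw [h1]
    have h2 := hli.repr_eq_single i ⟨ind A, hmem⟩ rfl
    simp [h2, i]

open Classical in
/-- A linear functional `L` with `L (1_A) = h A` for all `A ∈ 𝒜`. On the space of simple
functions, the only place where it is used, its values are determined by `h`; it exists by
`exists_linearExtension`. -/
noncomputable def linearExtension (𝒜 : Set (Set T)) (h : Set T → ℝ) : (T → ℝ) →ₗ[ℝ] ℝ :=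
  if H : ∃ L : (T → ℝ) →ₗ[ℝ] ℝ, ∀ A ∈ 𝒜, L (ind A) = h A then H.choose else 0

theorem linearExtension_ind {𝒜 : Set (Set T)} {mesh : ℕ → Set (Set T)}
    (h𝒜 : IsIndexingCollection 𝒜 mesh) (h : Set T → ℝ) (h0 : h ∅ = 0) {A : Set T}
    (hA : A ∈ 𝒜) : linearExtension 𝒜 h (ind A) = h A := by
  have H := exists_linearExtension h𝒜 h h0
  rw [linearExtension, dif_pos H]
  exact H.choose_spec A hA

theorem linearExtension_unique {𝒜 : Set (Set T)} {mesh : ℕ → Set (Set T)}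
    (h𝒜 : IsIndexingCollection 𝒜 mesh) (h : Set T → ℝ) (h0 : h ∅ = 0)
    (L : (T → ℝ) →ₗ[ℝ] ℝ) (hL : ∀ A ∈ 𝒜, L (ind A) = h A) {g : T → ℝ}
    (hg : g ∈ simpleFunctions 𝒜) : L g = linearExtension 𝒜 h g := by
  refine LinearMap.eqOn_span (s := ind '' 𝒜) ?_ hg
  rintro _ ⟨A, hA, rfl⟩
  rw [hL A hA, linearExtension_ind h𝒜 h h0 hA]

/-- The increment map `Δh(U)`, the additive extension of `h` from `𝒜` to finite unions of
increment sets. -/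
noncomputable def increment (𝒜 : Set (Set T)) (h : Set T → ℝ) (U : Set T) : ℝ :=
  linearExtension 𝒜 h (ind U)

end Collections

/-! ### Set-indexed Lévy processes and the stochastic integral -/

section Levy

variable {T Ω : Type*} [MeasurableSpace T] [MeasurableSpace Ω]

/-- The increment `ΔX_U` of a set-indexed process `X`. -/
noncomputable def processIncrement (𝒜 : Set (Set T)) (X : Set T → Ω → ℝ) (U : Set T) : Ω → ℝ :=
  fun ω => increment 𝒜 (fun A => X A ω) U

/-- `X` is a square-integrable set-indexed Lévy process with reference measure `m`. Values of `X`
outside `𝒜` are irrelevant. -/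
structure IsSetIndexedLevy (𝒜 : Set (Set T)) (m : Measure T) (P : Measure Ω)
    [IsProbabilityMeasure P] (X : Set T → Ω → ℝ) : Prop where
  measurable : ∀ A ∈ 𝒜, Measurable (X A)
  empty : ∀ ω, X ∅ ω = 0
  memLp : ∀ A ∈ 𝒜, MemLp (X A) 2 P
  indep_increments : ∀ (n : ℕ) (C : Fin n → Set T), (∀ i, C i ∈ incrementClass 𝒜) →
    Pairwise (fun i j => Disjoint (C i) (C j)) →
    iIndepFun (fun i => processIncrement 𝒜 X (C i)) P
  stationary_increments : ∀ C₁ ∈ incrementClass 𝒜, ∀ C₂ ∈ incrementClass 𝒜, m C₁ = m C₂ →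
    IdentDistrib (processIncrement 𝒜 X C₁) (processIncrement 𝒜 X C₂) P P
  outer_continuous : ∀ A : ℕ → Set T, (∀ n, A n ∈ 𝒜) → Antitone A →
    TendstoInDistribution (fun n => X (A n)) atTop (X (⋂ n, A n)) (fun _ => P) P

/-- The constant `|κ₁|`, where `𝔼[ΔX_C] = κ₁ m(C)`. For a set-indexed Lévy process with
Lévy-Khintchine triplet `(b, σ², ν)` one has `κ₁ = b + ∫_{|x|>1} x ν(dx)`; the quotients below
agree for all `A` with `m(A) > 0` and are `0 / 0 = 0` when `m(A) = 0`. -/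
noncomputable def meanRate (𝒜 : Set (Set T)) (m : Measure T) (P : Measure Ω)
    (X : Set T → Ω → ℝ) : ℝ≥0∞ :=
  ⨆ A ∈ 𝒜, ENNReal.ofReal |∫ ω, X A ω ∂P| / m A

/-- The constant `κ₂`, where `Var(ΔX_C) = κ₂ m(C)`. For a set-indexed Lévy process with
Lévy-Khintchine triplet `(b, σ², ν)` one has `κ₂ = σ² + ∫ x² ν(dx)`. -/
noncomputable def varRate (𝒜 : Set (Set T)) (m : Measure T) (P : Measure Ω)
    (X : Set T → Ω → ℝ) : ℝ≥0∞ :=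
  ⨆ A ∈ 𝒜, ENNReal.ofReal (variance (X A) P) / m A

/-- `‖g‖_{L(X)} = (κ₁² ‖g‖²_{L¹(m)} + κ₂ ‖g‖²_{L²(m)})^{1/2}`, with `0 · ∞ = 0`. -/
noncomputable def normLX (𝒜 : Set (Set T)) (m : Measure T) (P : Measure Ω)
    (X : Set T → Ω → ℝ) (g : T → ℝ) : ℝ≥0∞ :=
  (meanRate 𝒜 m P X ^ 2 * eLpNorm g 1 m ^ 2 + varRate 𝒜 m P X * eLpNorm g 2 m ^ 2) ^ (1 / 2 : ℝ)

/-- `f` is locally `X`-integrable: `f 1_A ∈ L(X)` for all `A ∈ 𝒜`. -/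
def IsLocallyIntegrable (𝒜 : Set (Set T)) (m : Measure T) (P : Measure Ω)
    (X : Set T → Ω → ℝ) (f : T → ℝ) : Prop :=
  Measurable f ∧ ∀ A ∈ 𝒜, normLX 𝒜 m P X (A.indicator f) < ∞

/-- The random variable `Z` is (a version of) the stochastic integral `∫ g dX`, the value at `g`
of the continuous extension to `L(X)` of the linear map `ℰ → L²(Ω)` with `1_A ↦ X_A`: it is the
limit in `L²(Ω)` of the integrals of simple functions that converge to `g` in `L(X)`. -/
def IsStochasticIntegral (𝒜 : Set (Set T)) (m : Measure T) (P : Measure Ω)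
    (X : Set T → Ω → ℝ) (g : T → ℝ) (Z : Ω → ℝ) : Prop :=
  Measurable Z ∧ ∃ φ : ℕ → T → ℝ, (∀ n, φ n ∈ simpleFunctions 𝒜) ∧
    Tendsto (fun n => normLX 𝒜 m P X (φ n - g)) atTop (𝓝 0) ∧
    Tendsto (fun n => eLpNorm (fun ω => linearExtension 𝒜 (fun A => X A ω) (φ n) - Z ω) 2 P)
      atTop (𝓝 0)

/-- `ℱ_{(A,ρ)} = σ(Y_A - Y_{A'} : A' ∈ 𝒜, 0 < d(A, A') < ρ)`. -/
def localSigmaAlgebra (𝒜 : Set (Set T)) (d : Set T → Set T → ℝ) (Y : Set T → Ω → ℝ)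
    (A : Set T) (ρ : ℝ) : MeasurableSpace Ω :=
  ⨆ A' ∈ {A' | A' ∈ 𝒜 ∧ 0 < d A A' ∧ d A A' < ρ},
    MeasurableSpace.comap (fun ω => Y A ω - Y A' ω) (borel ℝ)

/-- The germ σ-algebra `ℱ_{A+} = ⋂_{ρ > 0} ℱ_{(A,ρ)}`. -/
def germSigmaAlgebra (𝒜 : Set (Set T)) (d : Set T → Set T → ℝ) (Y : Set T → Ω → ℝ)
    (A : Set T) : MeasurableSpace Ω :=
  ⨅ ρ ∈ Set.Ioi (0 : ℝ), localSigmaAlgebra 𝒜 d Y A ρ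

end Levy

end SetIndexed

/-!
The stochastic integral is the continuous extension of `1_A ↦ X_A`, and its bound comes from two
facts about increments. By bisection, the midpoint property of `d_m` provides for each increment
set `C` a member of `𝒜` of the same measure (`exists_mem_measure_eq`), so that by stationarity the
mean and the variance of `ΔX_C` are at most `κ₁ m(C)` and `κ₂ m(C)`. A simple function is a linear
combination of indicators of disjoint increment sets (`exists_disjoint_representation`), so that
independence gives `‖∫ φ dX‖₂ ≤ κ₁ ‖φ‖₁ + κ₂^{1/2} ‖φ‖₂`. The right-hand side is a seminorm
equivalent to that of `L(X)`, and no finiteness of `κ₁` and `κ₂` is needed.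

The characteristic functional `Φ(g) = 𝔼[exp (i ∫ g dX)]` is continuous in this seminorm. The
identity `Φ(g) = Φ(g 1_U) Φ(g 1_{Uᶜ})` holds for `U ∈ 𝒜` because it holds for simple `g`; the
class of all `U` for which it holds is closed under complements and countable disjoint unions, so
by the π-λ theorem it contains every measurable set (`LevySetting.splits`). Thus integrals over
complementary sets are independent.

The variables `Y_A - Y_{A'}` that generate `ℱ_{(A,ρ)}` are integrals of functions that vanish
outside the vicinity of `A` of size `ρ`. An event `E` of the germ σ-algebra is therefore
independent of `∫ h 1_{Wᶜ} dX`, with `W` a measurable hull of that vicinity. As `ρ → 0`, `m(W) → 0`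
and these integrals converge to `∫ h dX`, so that `E` is independent of every stochastic integral
(`LevySetting.setIntegral_exp_stochInt_eq_of_tendsto`). But `E` is itself generated by stochastic
integrals, so it is independent of itself (`LevySetting.measure_eq_zero_or_one`). In both steps
independence of a generated σ-algebra is read off from characteristic functions of finite linear
combinations of the generators (`setIntegral_eq_of_integral_exp_mul_eq`).
-/

namespace SetIndexed

/-! ### Characteristic functions and generated σ-algebras -/

section CharFun

variable {Ω : Type*} [MeasurableSpace Ω]

/-- Two finite measures that integrate `exp (i Z)` equally, for every finite linear combination
`Z` of the random variables `ξ j`, agree on the σ-algebra generated by all the `ξ j`. -/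
theorem measure_eq_of_integral_exp_eq {ι : Type*} {μ ν : Measure Ω} [IsFiniteMeasure μ]
    [IsFiniteMeasure ν] {ξ : ι → Ω → ℝ} (hξ : ∀ j, Measurable (ξ j))
    (h : ∀ (s : Finset ι) (t : ι → ℝ),
      ∫ ω, Complex.exp ((∑ j ∈ s, t j * ξ j ω : ℝ) * Complex.I) ∂μ =
        ∫ ω, Complex.exp ((∑ j ∈ s, t j * ξ j ω : ℝ) * Complex.I) ∂ν)
    {E : Set Ω} (hE : MeasurableSet[⨆ j, MeasurableSpace.comap (ξ j) (borel ℝ)] E) :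
    μ E = ν E := by
  classical
  have hΞ : Measurable (fun ω j => ξ j ω) := measurable_pi_lambda _ hξ
  have key : μ.map (fun ω j => ξ j ω) = ν.map (fun ω j => ξ j ω) := by
    have h1 : ∀ ρ : Measure Ω, IsProjectiveLimit (ρ.map (fun ω j => ξ j ω))
        (fun s : Finset ι => ρ.map (fun ω (j : s) => ξ j ω)) := by
      intro ρ s
      rw [Measure.map_map (by fun_prop) hΞ]
      rfl
    have h2 : (fun s : Finset ι => μ.map (fun ω (j : s) => ξ j ω)) =
        fun s : Finset ι => ν.map (fun ω (j : s) => ξ j ω) := by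
      funext s
      have hs : Measurable (fun ω (j : s) => ξ j ω) := by fun_prop
      refine Measure.ext_of_charFunDual ?_
      funext L
      rw [charFunDual_apply, charFunDual_apply, integral_map hs.aemeasurable (by fun_prop),
        integral_map hs.aemeasurable (by fun_prop)]
      let t : ι → ℝ := fun j => if hj : j ∈ s then L (Pi.single ⟨j, hj⟩ 1) else 0
      have hL : ∀ ω, L (fun j : s => ξ j ω) = ∑ j ∈ s, t j * ξ j ω := by
        intro ω
        rw [← Finset.sum_coe_sort s (fun j => t j * ξ j ω)]
        conv_lhs => rw [← Finset.univ_sum_single (fun j : s => ξ j ω), map_sum]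
        refine Finset.sum_congr rfl fun j _ => ?_
        have : (Pi.single j (ξ j ω) : s → ℝ) = ξ j ω • Pi.single j 1 := by
          rw [← Pi.single_smul]; simp
        rw [this, map_smul]
        simp [t, mul_comm]
      simp only [hL]
      exact h s t
    have h3 := h1 μ
    rw [h2] at h3
    exact h3.unique (h1 ν)
  have hcomap : (⨆ j, MeasurableSpace.comap (ξ j) (borel ℝ)) =
      MeasurableSpace.comap (fun ω j => ξ j ω) MeasurableSpace.pi := by
    rw [MeasurableSpace.pi, MeasurableSpace.comap_iSup]
    refine iSup_congr fun j => ?_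
    rw [MeasurableSpace.comap_comp, BorelSpace.measurable_eq (α := ℝ)]
    rfl
  rw [hcomap] at hE
  obtain ⟨B, hB, rfl⟩ := hE
  rw [← Measure.map_apply hΞ hB, key, Measure.map_apply hΞ hB]

/-- If a bounded random variable `ψ` is uncorrelated with `exp (i Z)` for every finite linear
combination `Z` of the `ξ j`, then it is uncorrelated with every event generated by the `ξ j`. -/
theorem setIntegral_eq_of_integral_exp_mul_eq {ι : Type*} {P : Measure Ω} [IsProbabilityMeasure P]
    {ξ : ι → Ω → ℝ} (hξ : ∀ j, Measurable (ξ j)) {ψ : Ω → ℝ} (hψ : Measurable ψ)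
    (hψ1 : ∀ ω, |ψ ω| ≤ 1)
    (h : ∀ (s : Finset ι) (t : ι → ℝ),
      ∫ ω, Complex.exp ((∑ j ∈ s, t j * ξ j ω : ℝ) * Complex.I) * (ψ ω : ℂ) ∂P =
        (∫ ω, Complex.exp ((∑ j ∈ s, t j * ξ j ω : ℝ) * Complex.I) ∂P) * (∫ ω, ψ ω ∂P : ℝ))
    {E : Set Ω} (hE : MeasurableSet[⨆ j, MeasurableSpace.comap (ξ j) (borel ℝ)] E) :
    ∫ ω in E, ψ ω ∂P = P.real E * ∫ ω, ψ ω ∂P := by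
  have hle : (⨆ j, MeasurableSpace.comap (ξ j) (borel ℝ)) ≤ ‹MeasurableSpace Ω› := by
    refine iSup_le fun j => ?_
    rw [← BorelSpace.measurable_eq (α := ℝ)]
    exact (hξ j).comap_le
  have hEm : MeasurableSet E := hle _ hE
  have hψi : Integrable ψ P :=
    Integrable.of_bound hψ.aestronglyMeasurable 1 (Eventually.of_forall fun ω => hψ1 ω)
  have hψ0 : ∀ ω, 0 ≤ 1 + ψ ω := fun ω => by linarith [(abs_le.mp (hψ1 ω)).1]
  have hgi : Integrable (fun ω => 1 + ψ ω) P := (integrable_const 1).add hψi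
  have hc0 : 0 ≤ 1 + ∫ ω, ψ ω ∂P := by
    have := integral_nonneg (μ := P) (f := fun ω => 1 + ψ ω) hψ0
    rw [integral_add (integrable_const 1) hψi] at this
    simpa using this
  -- `1 + ψ ≥ 0`, so that both sides become finite measures with equal characteristic functions.
  set μ := P.withDensity (fun ω => ENNReal.ofReal (1 + ψ ω)) with hμ
  set ν := ENNReal.ofReal (1 + ∫ ω, ψ ω ∂P) • P with hν
  have : IsFiniteMeasure μ := isFiniteMeasure_withDensity_ofReal hgi.2
  have : IsFiniteMeasure ν := ⟨by simp [hν]⟩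
  have hkey := measure_eq_of_integral_exp_eq (μ := μ) (ν := ν) hξ (fun s t => by
    have hZ : Measurable (fun ω => Complex.exp ((∑ j ∈ s, t j * ξ j ω : ℝ) * Complex.I)) := by
      fun_prop
    have hb : ∀ ω, ‖Complex.exp ((∑ j ∈ s, t j * ξ j ω : ℝ) * Complex.I)‖ ≤ 1 := fun ω => by
      rw [Complex.norm_exp_ofReal_mul_I]
    have hZi : Integrable (fun ω => Complex.exp ((∑ j ∈ s, t j * ξ j ω : ℝ) * Complex.I)) P :=
      Integrable.of_bound hZ.aestronglyMeasurable 1 (Eventually.of_forall hb)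
    have hZψ : Integrable (fun ω =>
        Complex.exp ((∑ j ∈ s, t j * ξ j ω : ℝ) * Complex.I) * (ψ ω : ℂ)) P :=
      Integrable.of_bound (by fun_prop) 1 (Eventually.of_forall fun ω => by
        rw [norm_mul, Complex.norm_exp_ofReal_mul_I, one_mul, Complex.norm_real]
        exact hψ1 ω)
    rw [hμ, hν, integral_withDensity_eq_integral_toReal_smul (by fun_prop) (by simp),
      integral_smul_measure, ENNReal.toReal_ofReal hc0]
    have e : ∀ ω, (ENNReal.ofReal (1 + ψ ω)).toReal •
        Complex.exp ((∑ j ∈ s, t j * ξ j ω : ℝ) * Complex.I) =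
        Complex.exp ((∑ j ∈ s, t j * ξ j ω : ℝ) * Complex.I) +
        Complex.exp ((∑ j ∈ s, t j * ξ j ω : ℝ) * Complex.I) * (ψ ω : ℂ) := by
      intro ω
      rw [ENNReal.toReal_ofReal (hψ0 ω), Complex.real_smul]
      push_cast
      ring
    simp only [e]
    rw [integral_add hZi hZψ, h s t, Complex.real_smul]
    push_cast
    ring) hE
  rw [hμ, hν, withDensity_apply _ hEm, Measure.smul_apply, smul_eq_mul,
    ← ofReal_integral_eq_lintegral_ofReal hgi.integrableOn
      (Eventually.of_forall hψ0)] at hkey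
  have h4 := congrArg ENNReal.toReal hkey
  rw [ENNReal.toReal_mul, ENNReal.toReal_ofReal hc0,
    ENNReal.toReal_ofReal (integral_nonneg hψ0),
    integral_add (integrable_const 1).integrableOn hψi.integrableOn] at h4
  have h5 : (P E).toReal = P.real E := rfl
  simp only [integral_const, smul_eq_mul, mul_one, h5, measureReal_restrict_apply_univ] at h4
  linarith

end CharFun

/-! ### The weighted sum of the norms of `L¹(m)` and `L²(m)` -/

section WeightedNorm

variable {T : Type*} [MeasurableSpace T] {a b : ℝ≥0∞} {m : Measure T}

/-- The seminorm `a ‖g‖_{L¹(m)} + b ‖g‖_{L²(m)}`, with weights that may be infinite. -/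
noncomputable def weightedNorm (a b : ℝ≥0∞) (m : Measure T) (g : T → ℝ) : ℝ≥0∞ :=
  a * eLpNorm g 1 m + b * eLpNorm g 2 m

theorem weightedNorm_add_le {g h : T → ℝ} (hg : Measurable g) (hh : Measurable h) :
    weightedNorm a b m (g + h) ≤ weightedNorm a b m g + weightedNorm a b m h := by
  have h1 := eLpNorm_add_le (μ := m) hg.aestronglyMeasurable hh.aestronglyMeasurable le_rfl
  have h2 := eLpNorm_add_le (μ := m) hg.aestronglyMeasurable hh.aestronglyMeasurable
    (p := 2) (by norm_num)
  calc weightedNorm a b m (g + h)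
      ≤ a * (eLpNorm g 1 m + eLpNorm h 1 m) + b * (eLpNorm g 2 m + eLpNorm h 2 m) := by
        unfold weightedNorm; gcongr
    _ = _ := by unfold weightedNorm; ring

theorem weightedNorm_smul (c : ℝ) (g : T → ℝ) :
    weightedNorm a b m (c • g) = ‖c‖ₑ * weightedNorm a b m g := by
  simp only [weightedNorm, eLpNorm_const_smul]
  ring

theorem weightedNorm_sub_comm (g h : T → ℝ) :
    weightedNorm a b m (g - h) = weightedNorm a b m (h - g) := by
  simp only [weightedNorm, eLpNorm_sub_comm g h]

theorem weightedNorm_sub_le {f g h : T → ℝ} (hf : Measurable f) (hg : Measurable g)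
    (hh : Measurable h) :
    weightedNorm a b m (f - h) ≤ weightedNorm a b m (f - g) + weightedNorm a b m (g - h) := by
  rw [← sub_add_sub_cancel f g h]
  exact weightedNorm_add_le (hf.sub hg) (hg.sub hh)

theorem weightedNorm_indicator_le (g : T → ℝ) (U : Set T) :
    weightedNorm a b m (U.indicator g) ≤ weightedNorm a b m g := by
  unfold weightedNorm
  gcongr <;> exact eLpNorm_indicator_le g

/-- Finiteness of `c * x` suffices for `c * u i → 0` even if `c` or `x` is infinite, because then
the other factor vanishes. -/
theorem tendsto_const_mul_zero_of_le {ι : Type*} {l : Filter ι} {c x : ℝ≥0∞} {u : ι → ℝ≥0∞}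
    (hc : c * x < ∞) (hu : ∀ i, u i ≤ x) (h : x < ∞ → Tendsto u l (𝓝 0)) :
    Tendsto (fun i => c * u i) l (𝓝 0) := by
  rcases eq_or_ne c 0 with rfl | hc0
  · simpa using tendsto_const_nhds
  rcases eq_or_ne c ∞ with rfl | hct
  · have hx : x = 0 := by
      by_contra hx
      simp [ENNReal.top_mul hx] at hc
    have : ∀ i, u i = 0 := fun i => le_antisymm (hx ▸ hu i) zero_le
    simpa [this] using tendsto_const_nhds
  · have hx : x < ∞ := by
      by_contra hx
      rw [not_lt, top_le_iff] at hx
      simp [hx, ENNReal.mul_top hc0] at hc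
    simpa using ENNReal.Tendsto.const_mul (h hx) (Or.inr hct)

/-- The norm of `g 1_U` in terms of the measure with density `|g|^p`, which is finite for
`g ∈ L^p(m)`. -/
theorem eLpNorm_indicator_eq_withDensity {p : ℝ≥0∞} (hp0 : p ≠ 0) (hpt : p ≠ ∞) (g : T → ℝ)
    {U : Set T} (hU : MeasurableSet U) :
    eLpNorm (U.indicator g) p m =
      (m.withDensity (fun x => ‖g x‖ₑ ^ p.toReal) U) ^ (1 / p.toReal) := by
  rw [eLpNorm_indicator_eq_eLpNorm_restrict hU, eLpNorm_eq_lintegral_rpow_enorm_toReal hp0 hpt,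
    withDensity_apply _ hU]

theorem tendsto_eLpNorm_indicator_zero {ι : Type*} {l : Filter ι} {p : ℝ≥0∞} (hp0 : p ≠ 0)
    (hpt : p ≠ ∞) (g : T → ℝ) {D : ι → Set T} (hD : ∀ i, MeasurableSet (D i))
    (h : Tendsto (fun i => m.withDensity (fun x => ‖g x‖ₑ ^ p.toReal) (D i)) l (𝓝 0)) :
    Tendsto (fun i => eLpNorm ((D i).indicator g) p m) l (𝓝 0) := by
  have hp : 0 < 1 / p.toReal := by
    have := ENNReal.toReal_pos hp0 hpt
    positivity
  simp only [eLpNorm_indicator_eq_withDensity hp0 hpt g (hD _)]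
  have := (ENNReal.continuous_rpow_const (y := 1 / p.toReal)).tendsto 0
  rw [ENNReal.zero_rpow_of_pos hp] at this
  exact this.comp h

theorem withDensity_univ_lt_top {p : ℝ≥0∞} (hp0 : p ≠ 0) (hpt : p ≠ ∞) {g : T → ℝ}
    (hg : eLpNorm g p m < ∞) : m.withDensity (fun x => ‖g x‖ₑ ^ p.toReal) Set.univ < ∞ := by
  rw [withDensity_apply _ MeasurableSet.univ, Measure.restrict_univ]
  exact (eLpNorm_lt_top_iff_lintegral_rpow_enorm_lt_top hp0 hpt).mp hg

/-- The exponents `1` and `2` are not treated separately in the hypothesis. It is void for an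
exponent with `‖g‖_p = ∞`, whose weight is then zero. -/
theorem tendsto_weightedNorm_indicator_zero {ι : Type*} {l : Filter ι} {g : T → ℝ}
    (hg : weightedNorm a b m g < ∞) {D : ι → Set T} (hD : ∀ i, MeasurableSet (D i))
    (h : ∀ p : ℝ≥0∞, p ≠ 0 → p ≠ ∞ → eLpNorm g p m < ∞ →
      Tendsto (fun i => m.withDensity (fun x => ‖g x‖ₑ ^ p.toReal) (D i)) l (𝓝 0)) :
    Tendsto (fun i => weightedNorm a b m ((D i).indicator g)) l (𝓝 0) := by
  have hab := ENNReal.add_lt_top.mp hg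
  have h1 := tendsto_const_mul_zero_of_le (l := l) hab.1
    (fun i => eLpNorm_indicator_le (s := D i) g) (fun hx =>
      tendsto_eLpNorm_indicator_zero one_ne_zero ENNReal.one_ne_top g hD
        (h 1 one_ne_zero ENNReal.one_ne_top hx))
  have h2 := tendsto_const_mul_zero_of_le (l := l) hab.2
    (fun i => eLpNorm_indicator_le (s := D i) g) (fun hx =>
      tendsto_eLpNorm_indicator_zero two_ne_zero ENNReal.ofNat_ne_top g hD
        (h 2 two_ne_zero ENNReal.ofNat_ne_top hx))
  have h3 := h1.add h2
  rw [add_zero] at h3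
  exact h3

theorem tendsto_weightedNorm_indicator_of_measure {ι : Type*} {l : Filter ι} {g : T → ℝ}
    (hg : weightedNorm a b m g < ∞) {D : ι → Set T} (hD : ∀ i, MeasurableSet (D i))
    (h : Tendsto (fun i => m (D i)) l (𝓝 0)) :
    Tendsto (fun i => weightedNorm a b m ((D i).indicator g)) l (𝓝 0) := by
  refine tendsto_weightedNorm_indicator_zero hg hD fun p hp0 hpt hgp => ?_
  simp only [withDensity_apply _ (hD _)]
  refine tendsto_setLIntegral_zero ?_ h
  have := withDensity_univ_lt_top hp0 hpt hgp
  rw [withDensity_apply _ MeasurableSet.univ, Measure.restrict_univ] at this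
  exact this.ne

theorem tendsto_weightedNorm_indicator_of_antitone {g : T → ℝ}
    (hg : weightedNorm a b m g < ∞) {D : ℕ → Set T} (hD : ∀ i, MeasurableSet (D i))
    (hanti : Antitone D) (hempty : ⋂ n, D n = ∅) :
    Tendsto (fun i => weightedNorm a b m ((D i).indicator g)) atTop (𝓝 0) := by
  refine tendsto_weightedNorm_indicator_zero hg hD fun p hp0 hpt hgp => ?_
  have hfin := withDensity_univ_lt_top hp0 hpt hgp
  have := tendsto_measure_iInter_atTop (μ := m.withDensity (fun x => ‖g x‖ₑ ^ p.toReal))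
    (fun i => (hD i).nullMeasurableSet) hanti
    ⟨0, ((measure_mono (Set.subset_univ _)).trans_lt hfin).ne⟩
  rw [hempty, measure_empty] at this
  exact this

end WeightedNorm

/-! ### Increment sets and simple functions -/

section Collections

variable {T : Type*} {𝒜 : Set (Set T)} {mesh : ℕ → Set (Set T)}

theorem IsIndexingCollection.inter_mem (h𝒜 : IsIndexingCollection 𝒜 mesh) {A B : Set T}
    (hA : A ∈ 𝒜) (hB : B ∈ 𝒜) : A ∩ B ∈ 𝒜 := by
  have h := h𝒜.iInter_mem (fun n => if n = 0 then A else B) 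
    (fun n => by split_ifs <;> assumption)
  convert h using 1
  ext t
  simp only [Set.mem_inter_iff, Set.mem_iInter]
  constructor
  · rintro ⟨h1, h2⟩ n
    split_ifs <;> assumption
  · intro h
    exact ⟨by simpa using h 0, by simpa using h 1⟩

theorem IsIndexingCollection.isPiSystem (h𝒜 : IsIndexingCollection 𝒜 mesh) : IsPiSystem 𝒜 :=
  fun _ hA _ hB _ => h𝒜.inter_mem hA hB

theorem IsIndexingCollection.biInter_mem (h𝒜 : IsIndexingCollection 𝒜 mesh) {u : Finset (Set T)}
    (hu : u.Nonempty) (h : ∀ B ∈ u, B ∈ 𝒜) : ⋂ B ∈ u, B ∈ 𝒜 := by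
  classical
  induction hu using Finset.Nonempty.cons_induction with
  | singleton B => simpa using h
  | cons B u hB hu ih =>
    rw [Finset.cons_eq_insert, Finset.set_biInter_insert]
    exact h𝒜.inter_mem (h B (by simp)) (ih fun B' hB' => h B' (by simp [hB']))

theorem empty_mem_incrementClass (h𝒜 : IsIndexingCollection 𝒜 mesh) :
    ∅ ∈ incrementClass 𝒜 := ⟨∅, h𝒜.empty_mem, ∅, by simp, by simp⟩

theorem mem_incrementClass {A : Set T} (hA : A ∈ 𝒜) : A ∈ incrementClass 𝒜 :=
  ⟨A, hA, ∅, by simp, by simp⟩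

theorem ind_mem_simpleFunctions {A : Set T} (hA : A ∈ 𝒜) : ind A ∈ simpleFunctions 𝒜 :=
  Submodule.subset_span ⟨A, hA, rfl⟩

theorem indicator_mem_simpleFunctions (h𝒜 : IsIndexingCollection 𝒜 mesh) {B : Set T}
    (hB : B ∈ 𝒜) {φ : T → ℝ} (hφ : φ ∈ simpleFunctions 𝒜) :
    B.indicator φ ∈ simpleFunctions 𝒜 := by
  induction hφ using Submodule.span_induction with
  | mem x hx =>
    obtain ⟨A, hA, rfl⟩ := hx
    rw [ind, Set.indicator_indicator]
    exact ind_mem_simpleFunctions (h𝒜.inter_mem hB hA)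
  | zero => simp
  | add x y _ _ hx hy =>
    rw [Set.indicator_add']
    exact add_mem hx hy
  | smul c x _ hx =>
    have : B.indicator (c • x) = c • B.indicator x := Set.indicator_const_smul B c x
    rw [this]
    exact Submodule.smul_mem _ c hx

theorem indicator_compl_mem_simpleFunctions (h𝒜 : IsIndexingCollection 𝒜 mesh) {B : Set T}
    (hB : B ∈ 𝒜) {φ : T → ℝ} (hφ : φ ∈ simpleFunctions 𝒜) :
    Bᶜ.indicator φ ∈ simpleFunctions 𝒜 := by
  rw [Set.indicator_compl]
  exact sub_mem hφ (indicator_mem_simpleFunctions h𝒜 hB hφ)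

theorem ind_mem_simpleFunctions_of_mem_incrementClass (h𝒜 : IsIndexingCollection 𝒜 mesh)
    {C : Set T} (hC : C ∈ incrementClass 𝒜) : ind C ∈ simpleFunctions 𝒜 := by
  classical
  obtain ⟨A, hA, s, hs, rfl⟩ := hC
  induction s using Finset.induction_on with
  | empty => simpa using ind_mem_simpleFunctions hA
  | insert B s _ ih =>
    have h1 := indicator_compl_mem_simpleFunctions h𝒜 (hs B (by simp))
      (ih fun B' hB' => hs B' (by simp [hB']))
    rw [ind, Set.indicator_indicator] at h1
    have h2 : A \ ⋃ B' ∈ insert B s, B' = Bᶜ ∩ (A \ ⋃ B' ∈ s, B') := by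
      rw [Finset.set_biUnion_insert]
      ext t
      simp only [Set.mem_sdiff, Set.mem_union, Set.mem_inter_iff, Set.mem_compl_iff]
      tauto
    rw [h2]
    exact h1

open Classical in
/-- The atom of the finite collection `s` made up of the points that belong to exactly those
members of `s` that are in `u`. The atom of points outside all members of `s`, which is not an
increment set in general, is replaced by `∅`. -/
noncomputable def atom (s u : Finset (Set T)) : Set T :=
  {t | u.Nonempty ∧ s.filter (fun B => t ∈ B) = u}

theorem atom_mem_incrementClass (h𝒜 : IsIndexingCollection 𝒜 mesh) {s u : Finset (Set T)}
    (hs : ∀ B ∈ s, B ∈ 𝒜) : atom s u ∈ incrementClass 𝒜 := by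
  classical
  by_cases h : u.Nonempty ∧ u ⊆ s
  · refine ⟨_, h𝒜.biInter_mem h.1 (fun B hB => hs B (h.2 hB)), s \ u,
      fun B hB => hs B (Finset.mem_sdiff.mp hB).1, ?_⟩
    ext t
    simp only [atom, h.1, true_and, Set.mem_ofPred_eq, Set.mem_sdiff, Set.mem_iInter,
      Set.mem_iUnion, Finset.mem_sdiff, not_exists]
    constructor
    · rintro rfl
      simp +contextual
    · rintro ⟨h1, h2⟩
      ext B
      rw [Finset.mem_filter]
      constructor
      · rintro ⟨hB, ht⟩
        by_contra hBu
        exact h2 B ⟨hB, hBu⟩ ht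
      · exact fun hB => ⟨h.2 hB, h1 B hB⟩
  · convert empty_mem_incrementClass h𝒜
    ext t
    simp only [atom, Set.mem_ofPred_eq, Set.mem_empty_iff_false, iff_false]
    rintro ⟨h1, rfl⟩
    exact h ⟨h1, Finset.filter_subset _ _⟩

/-- A simple function is a linear combination of indicators of disjoint increment sets, which may
be chosen to be compatible with a given member `A` of the indexing collection. -/
theorem exists_disjoint_representation (h𝒜 : IsIndexingCollection 𝒜 mesh) {φ : T → ℝ}
    (hφ : φ ∈ simpleFunctions 𝒜) {A : Set T} (hA : A ∈ 𝒜) :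
    ∃ (n : ℕ) (C : Fin n → Set T) (a : Fin n → ℝ), (∀ i, C i ∈ incrementClass 𝒜) ∧
      Pairwise (fun i j => Disjoint (C i) (C j)) ∧ φ = ∑ i, a i • ind (C i) ∧
      ∀ i, C i ⊆ A ∨ Disjoint (C i) A := by
  classical
  obtain ⟨s, c, hs, hφs⟩ : ∃ (s : Finset (Set T)) (c : Set T → ℝ), (∀ B ∈ s, B ∈ 𝒜) ∧
      φ = ∑ B ∈ s, c B • ind B := by
    rw [simpleFunctions, Submodule.mem_span_image_iff_exists_fun] at hφ
    obtain ⟨s, hs, c, hc⟩ := hφ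
    refine ⟨s, fun B => if h : B ∈ s then c ⟨B, h⟩ else 0, fun B hB => hs hB, ?_⟩
    rw [← hc, ← Finset.sum_coe_sort s]
    simp
  set s' := insert A s with hs'
  have hs'𝒜 : ∀ B ∈ s', B ∈ 𝒜 := by
    intro B hB
    rcases Finset.mem_insert.mp hB with rfl | hB
    exacts [hA, hs B hB]
  let e := s'.powerset.equivFin
  refine ⟨_, fun i => atom s' (e.symm i).1, fun i => ∑ B ∈ (e.symm i).1 ∩ s, c B,
    fun i => atom_mem_incrementClass h𝒜 hs'𝒜, ?_, ?_, ?_⟩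
  · intro i j hij
    refine Set.disjoint_left.mpr fun t hti htj => hij ?_
    exact e.symm.injective (Subtype.ext (hti.2.symm.trans htj.2))
  · ext t
    rw [e.symm.sum_comp (fun u => (∑ B ∈ u.1 ∩ s, c B) • ind (atom s' u.1)),
      Finset.sum_coe_sort s'.powerset (fun u => (∑ B ∈ u ∩ s, c B) • ind (atom s' u)), hφs]
    simp only [Finset.sum_apply, Pi.smul_apply, smul_eq_mul]
    -- Only the atom that contains `t`, if there is one, contributes to the sum.
    rw [Finset.sum_eq_single (s'.filter (fun B => t ∈ B))]
    · have h1 : s'.filter (fun B => t ∈ B) ∩ s = s.filter (fun B => t ∈ B) := by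
        ext B
        simp only [hs', Finset.mem_inter, Finset.mem_filter, Finset.mem_insert]
        tauto
      have h2 : ∑ B ∈ s, c B * ind B t = ∑ B ∈ s.filter (fun B => t ∈ B), c B := by
        rw [Finset.sum_filter]
        refine Finset.sum_congr rfl fun B _ => ?_
        by_cases hB : t ∈ B <;> simp [ind, hB]
      rw [h1, h2]
      by_cases hne : (s'.filter (fun B => t ∈ B)).Nonempty
      · have : t ∈ atom s' (s'.filter (fun B => t ∈ B)) := ⟨hne, rfl⟩
        simp [ind, this]
      · have h3 : s.filter (fun B => t ∈ B) = ∅ := by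
          rw [← h1, Finset.not_nonempty_iff_eq_empty.mp hne, Finset.empty_inter]
        simp [h3]
    · intro u _ hu
      have : t ∉ atom s' u := fun h => hu h.2.symm
      simp [ind, this]
    · intro h
      exact absurd (Finset.mem_powerset.mpr (Finset.filter_subset _ _)) h
  · intro i
    by_cases hAi : A ∈ (e.symm i).1
    · left
      intro t ht
      rw [← ht.2] at hAi
      exact (Finset.mem_filter.mp hAi).2
    · right
      refine Set.disjoint_left.mpr fun t ht htA => hAi ?_
      rw [← ht.2]
      exact Finset.mem_filter.mpr ⟨by simp [hs'], htA⟩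

/-- A function of a linear combination of indicators of disjoint sets. -/
theorem apply_sum_smul_ind {n : ℕ} {C : Fin n → Set T}
    (hC : Pairwise (fun i j => Disjoint (C i) (C j))) (a : Fin n → ℝ) (F : ℝ → ℝ≥0∞)
    (hF : F 0 = 0) (t : T) :
    F ((∑ i, a i • ind (C i)) t) = ∑ i, (C i).indicator (fun _ => F (a i)) t := by
  simp only [Finset.sum_apply, Pi.smul_apply, smul_eq_mul]
  by_cases h : ∃ i, t ∈ C i
  · obtain ⟨i, hi⟩ := h
    have hj : ∀ j, j ≠ i → t ∉ C j := fun j hji hj => Set.disjoint_left.mp (hC hji) hj hi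
    rw [Finset.sum_eq_single i (fun j _ hji => by simp [ind, hj j hji]) (by simp),
      Finset.sum_eq_single i (fun j _ hji => by simp [hj j hji]) (by simp)]
    simp [ind, hi]
  · push Not at h
    simp [ind, h, hF]

end Collections

/-! ### Values of the reference measure -/

section Measure

variable {T : Type*} {𝒜 : Set (Set T)} {mesh : ℕ → Set (Set T)} [mT : MeasurableSpace T]
  {m : Measure T}

theorem measurableSet_of_mem_incrementClass (h𝒜m : ∀ A ∈ 𝒜, MeasurableSet A) {C : Set T}
    (hC : C ∈ incrementClass 𝒜) : MeasurableSet C := by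
  obtain ⟨A, hA, s, hs, rfl⟩ := hC
  exact (h𝒜m A hA).diff (Finset.measurableSet_biUnion s fun B hB => h𝒜m B (hs B hB))

theorem measurable_ind {U : Set T} (hU : MeasurableSet U) : Measurable (ind U) :=
  (measurable_one).indicator hU

theorem measurable_of_mem_simpleFunctions (h𝒜m : ∀ A ∈ 𝒜, MeasurableSet A) {φ : T → ℝ}
    (hφ : φ ∈ simpleFunctions 𝒜) : Measurable φ := by
  induction hφ using Submodule.span_induction with
  | mem x hx =>
    obtain ⟨A, hA, rfl⟩ := hx
    exact measurable_ind (h𝒜m A hA)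
  | zero => exact measurable_zero
  | add x y _ _ hx hy => exact hx.add hy
  | smul c x _ hx => exact hx.const_smul c

/-- The midpoint property of `d_m` makes `m` take all intermediate values on `𝒜`: bisection gives
a decreasing sequence in `𝒜` whose measures converge to the prescribed value. -/
theorem exists_mem_measureReal_eq (h𝒜 : IsIndexingCollection 𝒜 mesh)
    (h𝒜m : ∀ A ∈ 𝒜, MeasurableSet A) (hm : ∀ A ∈ 𝒜, m A < ∞)
    (hdm : IsCompatibleMetric 𝒜 mesh (fun A A' => (m (A ∆ A')).toReal)) {A : Set T} (hA : A ∈ 𝒜)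
    {r : ℝ} (hr0 : 0 ≤ r) (hr : r ≤ m.real A) : ∃ A' ∈ 𝒜, m.real A' = r := by
  have hdist : ∀ B ∈ 𝒜, ∀ B' ∈ 𝒜, B ⊆ B' → (m (B ∆ B')).toReal = m.real B' - m.real B := by
    intro B hB B' hB' hBB'
    rw [Set.symmDiff_def, Set.sdiff_eq_empty.mpr hBB', Set.empty_union]
    exact measureReal_sdiff hBB' (h𝒜m B hB) (hm B' hB').ne
  let S := {p : Set T × Set T // p.1 ∈ 𝒜 ∧ p.2 ∈ 𝒜 ∧ p.1 ⊆ p.2 ∧ m.real p.1 ≤ r ∧ r ≤ m.real p.2}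
  have step : ∀ p : S, ∃ q : S, q.1.2 ⊆ p.1.2 ∧
      m.real q.1.2 - m.real q.1.1 = (m.real p.1.2 - m.real p.1.1) / 2 := by
    rintro ⟨⟨B, B'⟩, hB, hB', hBB', h1, h2⟩
    obtain ⟨M, hM, hBM, hMB', h3, h4⟩ := hdm.midpoint B hB B' hB' hBB'
    rw [hdist B hB B' hB' hBB', hdist B hB M hM hBM] at h3
    rw [hdist B hB B' hB' hBB', hdist M hM B' hB' hMB'] at h4
    rcases le_total (m.real M) r with h | h
    · exact ⟨⟨(M, B'), hM, hB', hMB', h, h2⟩, subset_rfl, h4⟩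
    · exact ⟨⟨(B, M), hB, hM, hBM, h1, h⟩, hMB', h3⟩
  choose next hnext1 hnext2 using step
  let p : ℕ → S := fun n => Nat.rec
    ⟨(∅, A), h𝒜.empty_mem, hA, Set.empty_subset _, by simpa using hr0, hr⟩ (fun _ q => next q) n
  have hanti : Antitone (fun n => (p n).1.2) := antitone_nat_of_succ_le fun n => hnext1 (p n)
  have hgap : ∀ n, m.real (p n).1.2 - m.real (p n).1.1 = m.real A / 2 ^ n := by
    intro n
    induction n with
    | zero => simp [p]
    | succ n ih =>
      have : p (n + 1) = next (p n) := rfl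
      rw [this, hnext2, ih, pow_succ]
      ring
  refine ⟨⋂ n, (p n).1.2, h𝒜.iInter_mem _ fun n => (p n).2.2.1, ?_⟩
  have hlim : Tendsto (fun n => m.real (p n).1.2) atTop (𝓝 (m.real (⋂ n, (p n).1.2))) := by
    refine (ENNReal.tendsto_toReal ?_).comp (tendsto_measure_iInter_atTop
      (fun n => (h𝒜m _ (p n).2.2.1).nullMeasurableSet) hanti ⟨0, (hm _ (p 0).2.2.1).ne⟩)
    exact (hm _ (h𝒜.iInter_mem _ fun n => (p n).2.2.1)).ne
  have hlim2 : Tendsto (fun n => m.real (p n).1.2) atTop (𝓝 r) := by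
    have hz : Tendsto (fun n : ℕ => r + m.real A / 2 ^ n) atTop (𝓝 r) := by
      have := (tendsto_const_nhds (x := m.real A)).div_atTop
        (tendsto_pow_atTop_atTop_of_one_lt (one_lt_two (α := ℝ)))
      simpa using this.const_add r
    refine tendsto_of_tendsto_of_tendsto_of_le_of_le tendsto_const_nhds hz
      (fun n => (p n).2.2.2.2.2) (fun n => ?_)
    have h1 := hgap n
    have h2 := (p n).2.2.2.2.1
    dsimp only
    linarith
  exact tendsto_nhds_unique hlim hlim2

theorem measure_lt_top_of_mem_incrementClass (hm : ∀ A ∈ 𝒜, m A < ∞) {C : Set T}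
    (hC : C ∈ incrementClass 𝒜) : m C < ∞ := by
  obtain ⟨A, hA, s, hs, rfl⟩ := hC
  exact (measure_mono Set.sdiff_subset).trans_lt (hm A hA)

theorem exists_mem_measure_eq (h𝒜 : IsIndexingCollection 𝒜 mesh)
    (h𝒜m : ∀ A ∈ 𝒜, MeasurableSet A) (hm : ∀ A ∈ 𝒜, m A < ∞)
    (hdm : IsCompatibleMetric 𝒜 mesh (fun A A' => (m (A ∆ A')).toReal)) {C : Set T}
    (hC : C ∈ incrementClass 𝒜) : ∃ A' ∈ 𝒜, m A' = m C := by
  have hCt := measure_lt_top_of_mem_incrementClass hm hC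
  obtain ⟨A, hA, s, hs, rfl⟩ := hC
  obtain ⟨A', hA', h⟩ := exists_mem_measureReal_eq h𝒜 h𝒜m hm hdm hA
    (r := m.real (A \ ⋃ B ∈ s, B)) measureReal_nonneg
    (measureReal_mono Set.sdiff_subset (hm A hA).ne)
  exact ⟨A', hA', (ENNReal.toReal_eq_toReal_iff' (hm A' hA').ne hCt.ne).mp h⟩

theorem lintegral_apply_sum_smul_ind {n : ℕ} {C : Fin n → Set T}
    (hCm : ∀ i, MeasurableSet (C i)) (hC : Pairwise (fun i j => Disjoint (C i) (C j)))
    (a : Fin n → ℝ) (F : ℝ → ℝ≥0∞) (hF : F 0 = 0) :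
    ∫⁻ t, F ((∑ i, a i • ind (C i)) t) ∂m = ∑ i, F (a i) * m (C i) := by
  simp only [apply_sum_smul_ind hC a F hF]
  rw [lintegral_finsetSum _ fun i _ => measurable_const.indicator (hCm i)]
  simp [lintegral_indicator_const (hCm _)]

end Measure

/-! ### Integrals of simple functions -/

section SimpleIntegral

variable {T Ω : Type*} {𝒜 : Set (Set T)} {X : Set T → Ω → ℝ}

/-- The integral `∫ φ dX` of a simple function `φ`. -/
noncomputable def simpleIntegral (𝒜 : Set (Set T)) (X : Set T → Ω → ℝ) (φ : T → ℝ) : Ω → ℝ :=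
  fun ω => linearExtension 𝒜 (fun A => X A ω) φ

theorem simpleIntegral_add (φ ψ : T → ℝ) :
    simpleIntegral 𝒜 X (φ + ψ) = simpleIntegral 𝒜 X φ + simpleIntegral 𝒜 X ψ := by
  ext ω; simp [simpleIntegral]

theorem simpleIntegral_sub (φ ψ : T → ℝ) :
    simpleIntegral 𝒜 X (φ - ψ) = simpleIntegral 𝒜 X φ - simpleIntegral 𝒜 X ψ := by
  ext ω; simp [simpleIntegral]

theorem simpleIntegral_smul (c : ℝ) (φ : T → ℝ) :
    simpleIntegral 𝒜 X (c • φ) = c • simpleIntegral 𝒜 X φ := by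
  ext ω; simp [simpleIntegral]

theorem simpleIntegral_zero : simpleIntegral 𝒜 X 0 = 0 := by
  ext ω; simp [simpleIntegral]

theorem simpleIntegral_sum_smul {n : ℕ} (a : Fin n → ℝ) (φ : Fin n → T → ℝ) :
    simpleIntegral 𝒜 X (∑ i, a i • φ i) = ∑ i, a i • simpleIntegral 𝒜 X (φ i) := by
  ext ω
  simp [simpleIntegral]

variable {mesh : ℕ → Set (Set T)} [MeasurableSpace T] {m : Measure T} [MeasurableSpace Ω]
  {P : Measure Ω}

/-- The seminorm `κ₁ ‖g‖_{L¹(m)} + κ₂^{1/2} ‖g‖_{L²(m)}`, which is equivalent to the seminorm of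
`L(X)`. -/
noncomputable abbrev levyNorm (𝒜 : Set (Set T)) (m : Measure T) (P : Measure Ω)
    (X : Set T → Ω → ℝ) (g : T → ℝ) : ℝ≥0∞ :=
  weightedNorm (meanRate 𝒜 m P X) (varRate 𝒜 m P X ^ (1 / 2 : ℝ)) m g

theorem levyNorm_le_two_mul_normLX (g : T → ℝ) :
    levyNorm 𝒜 m P X g ≤ 2 * normLX 𝒜 m P X g := by
  have hsq : ∀ x : ℝ≥0∞, (x ^ 2) ^ (1 / 2 : ℝ) = x := fun x => by
    rw [← ENNReal.rpow_natCast, ← ENNReal.rpow_mul]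
    norm_num
  rw [two_mul, levyNorm, weightedNorm, normLX]
  gcongr
  · calc meanRate 𝒜 m P X * eLpNorm g 1 m
        = (meanRate 𝒜 m P X ^ 2 * eLpNorm g 1 m ^ 2) ^ (1 / 2 : ℝ) := by rw [← mul_pow, hsq]
      _ ≤ _ := ENNReal.rpow_le_rpow le_self_add (by norm_num)
  · calc varRate 𝒜 m P X ^ (1 / 2 : ℝ) * eLpNorm g 2 m
        = (varRate 𝒜 m P X * eLpNorm g 2 m ^ 2) ^ (1 / 2 : ℝ) := by
          rw [ENNReal.mul_rpow_of_nonneg _ _ (by norm_num), hsq]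
      _ ≤ _ := ENNReal.rpow_le_rpow le_add_self (by norm_num)

variable [IsProbabilityMeasure P]

theorem IsSetIndexedLevy.simpleIntegral_ind (h𝒜 : IsIndexingCollection 𝒜 mesh)
    (hX : IsSetIndexedLevy 𝒜 m P X) {A : Set T} (hA : A ∈ 𝒜) :
    simpleIntegral 𝒜 X (ind A) = X A := by
  ext ω
  exact linearExtension_ind h𝒜 (fun A => X A ω) (hX.empty ω) hA

theorem IsSetIndexedLevy.measurable_simpleIntegral (h𝒜 : IsIndexingCollection 𝒜 mesh)
    (hX : IsSetIndexedLevy 𝒜 m P X) {φ : T → ℝ} (hφ : φ ∈ simpleFunctions 𝒜) :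
    Measurable (simpleIntegral 𝒜 X φ) := by
  induction hφ using Submodule.span_induction with
  | mem x hx =>
    obtain ⟨A, hA, rfl⟩ := hx
    rw [hX.simpleIntegral_ind h𝒜 hA]
    exact hX.measurable A hA
  | zero => rw [simpleIntegral_zero]; exact measurable_zero
  | add x y _ _ hx hy => rw [simpleIntegral_add]; exact hx.add hy
  | smul c x _ hx => rw [simpleIntegral_smul]; exact hx.const_smul c

theorem IsSetIndexedLevy.memLp_simpleIntegral (h𝒜 : IsIndexingCollection 𝒜 mesh)
    (hX : IsSetIndexedLevy 𝒜 m P X) {φ : T → ℝ} (hφ : φ ∈ simpleFunctions 𝒜) :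
    MemLp (simpleIntegral 𝒜 X φ) 2 P := by
  induction hφ using Submodule.span_induction with
  | mem x hx =>
    obtain ⟨A, hA, rfl⟩ := hx
    rw [hX.simpleIntegral_ind h𝒜 hA]
    exact hX.memLp A hA
  | zero => rw [simpleIntegral_zero]; exact MemLp.zero
  | add x y _ _ hx hy => rw [simpleIntegral_add]; exact hx.add hy
  | smul c x _ hx => rw [simpleIntegral_smul]; exact hx.const_smul c

/-- A member of `𝒜` with the same measure has the same increment in law, and `∅` serves this
purpose if the measure is zero. -/
theorem IsSetIndexedLevy.exists_identDistrib (h𝒜 : IsIndexingCollection 𝒜 mesh)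
    (h𝒜m : ∀ A ∈ 𝒜, MeasurableSet A) (hm : ∀ A ∈ 𝒜, m A < ∞)
    (hdm : IsCompatibleMetric 𝒜 mesh (fun A A' => (m (A ∆ A')).toReal))
    (hX : IsSetIndexedLevy 𝒜 m P X) {C : Set T} (hC : C ∈ incrementClass 𝒜) :
    ∃ A ∈ 𝒜, m A = m C ∧ IdentDistrib (simpleIntegral 𝒜 X (ind C)) (X A) P P ∧
      (m A = 0 → X A = 0) := by
  obtain ⟨A, hA, hAC, hA0⟩ : ∃ A ∈ 𝒜, m A = m C ∧ (m A = 0 → A = ∅) := by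
    by_cases h0 : m C = 0
    · exact ⟨∅, h𝒜.empty_mem, by simp [h0], fun _ => rfl⟩
    · obtain ⟨A, hA, hAC⟩ := exists_mem_measure_eq h𝒜 h𝒜m hm hdm hC
      exact ⟨A, hA, hAC, fun h => absurd (hAC ▸ h) h0⟩
  refine ⟨A, hA, hAC, ?_, fun h => ?_⟩
  · rw [← hX.simpleIntegral_ind h𝒜 hA]
    exact hX.stationary_increments C hC A (mem_incrementClass hA) hAC.symm
  · rw [hA0 h]
    ext ω
    exact hX.empty ω

theorem IsSetIndexedLevy.enorm_integral_increment_le (h𝒜 : IsIndexingCollection 𝒜 mesh)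
    (h𝒜m : ∀ A ∈ 𝒜, MeasurableSet A) (hm : ∀ A ∈ 𝒜, m A < ∞)
    (hdm : IsCompatibleMetric 𝒜 mesh (fun A A' => (m (A ∆ A')).toReal))
    (hX : IsSetIndexedLevy 𝒜 m P X) {C : Set T} (hC : C ∈ incrementClass 𝒜) :
    ‖∫ ω, simpleIntegral 𝒜 X (ind C) ω ∂P‖ₑ ≤ meanRate 𝒜 m P X * m C := by
  obtain ⟨A, hA, hAC, hid, h0⟩ := hX.exists_identDistrib h𝒜 h𝒜m hm hdm hC
  rw [hid.integral_eq, ← hAC]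
  by_cases hA0 : m A = 0
  · simp [h0 hA0]
  · rw [← ENNReal.div_le_iff hA0 (hm A hA).ne, Real.enorm_eq_ofReal_abs]
    exact le_iSup₂_of_le A hA le_rfl

theorem IsSetIndexedLevy.variance_increment_le (h𝒜 : IsIndexingCollection 𝒜 mesh)
    (h𝒜m : ∀ A ∈ 𝒜, MeasurableSet A) (hm : ∀ A ∈ 𝒜, m A < ∞)
    (hdm : IsCompatibleMetric 𝒜 mesh (fun A A' => (m (A ∆ A')).toReal))
    (hX : IsSetIndexedLevy 𝒜 m P X) {C : Set T} (hC : C ∈ incrementClass 𝒜) :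
    ENNReal.ofReal (variance (simpleIntegral 𝒜 X (ind C)) P) ≤ varRate 𝒜 m P X * m C := by
  obtain ⟨A, hA, hAC, hid, h0⟩ := hX.exists_identDistrib h𝒜 h𝒜m hm hdm hC
  rw [hid.variance_eq, ← hAC]
  by_cases hA0 : m A = 0
  · simp [h0 hA0]
  · rw [← ENNReal.div_le_iff hA0 (hm A hA).ne]
    exact le_iSup₂_of_le A hA le_rfl

/-- The integral of simple functions is bounded from `L(X)` to `L²(Ω)`: the mean is controlled by
the norm of `L¹(m)`, and the centred part, by independence of the increments on disjoint sets, by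
the norm of `L²(m)`. -/
theorem IsSetIndexedLevy.eLpNorm_simpleIntegral_le (h𝒜 : IsIndexingCollection 𝒜 mesh)
    (h𝒜m : ∀ A ∈ 𝒜, MeasurableSet A) (hm : ∀ A ∈ 𝒜, m A < ∞)
    (hdm : IsCompatibleMetric 𝒜 mesh (fun A A' => (m (A ∆ A')).toReal))
    (hX : IsSetIndexedLevy 𝒜 m P X) {φ : T → ℝ} (hφ : φ ∈ simpleFunctions 𝒜) :
    eLpNorm (simpleIntegral 𝒜 X φ) 2 P ≤ levyNorm 𝒜 m P X φ := by
  obtain ⟨n, C, a, hC, hdisj, rfl, -⟩ := exists_disjoint_representation h𝒜 hφ h𝒜.empty_mem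
  have hCm := fun i => measurableSet_of_mem_incrementClass h𝒜m (hC i)
  have hCs := fun i => ind_mem_simpleFunctions_of_mem_incrementClass h𝒜 (hC i)
  set ξ : Fin n → Ω → ℝ := fun i => simpleIntegral 𝒜 X (ind (C i)) with hξ
  have hξL : ∀ i, MemLp (ξ i) 2 P := fun i => hX.memLp_simpleIntegral h𝒜 (hCs i)
  set Z := simpleIntegral 𝒜 X (∑ i, a i • ind (C i)) with hZdef
  have hZ : Z = ∑ i, a i • ξ i := simpleIntegral_sum_smul a _
  have hZL : MemLp Z 2 P := hX.memLp_simpleIntegral h𝒜 hφ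
  have hmean : ‖∫ ω, Z ω ∂P‖ₑ ≤ meanRate 𝒜 m P X * eLpNorm (∑ i, a i • ind (C i)) 1 m := by
    rw [eLpNorm_one_eq_lintegral_enorm,
      lintegral_apply_sum_smul_ind hCm hdisj a (fun x => ‖x‖ₑ) (by simp), hZ, Finset.mul_sum]
    have : ∫ ω, (∑ i, a i • ξ i) ω ∂P = ∑ i, a i * ∫ ω, ξ i ω ∂P := by
      simp only [Finset.sum_apply, Pi.smul_apply, smul_eq_mul]
      rw [integral_finsetSum _ fun i _ => ((hξL i).integrable (by norm_num)).const_mul (a i)]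
      simp only [integral_const_mul]
    rw [this]
    refine (enorm_sum_le _ _).trans (Finset.sum_le_sum fun i _ => ?_)
    rw [enorm_mul, mul_left_comm]
    gcongr
    exact hX.enorm_integral_increment_le h𝒜 h𝒜m hm hdm (hC i)
  have hvar : eLpNorm (fun ω => Z ω - ∫ ω', Z ω' ∂P) 2 P ≤
      varRate 𝒜 m P X ^ (1 / 2 : ℝ) * eLpNorm (∑ i, a i • ind (C i)) 2 m := by
    have h1 : ENNReal.ofReal (variance Z P) ≤
        varRate 𝒜 m P X * ∫⁻ t, ‖(∑ i, a i • ind (C i)) t‖ₑ ^ 2 ∂m := by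
      rw [lintegral_apply_sum_smul_ind hCm hdisj a (fun x => ‖x‖ₑ ^ 2) (by simp), hZ,
        IndepFun.variance_sum (fun i _ => (hξL i).const_smul (a i)), Finset.mul_sum,
        ENNReal.ofReal_sum_of_nonneg fun i _ => variance_nonneg _ _]
      · refine Finset.sum_le_sum fun i _ => ?_
        rw [variance_smul, ENNReal.ofReal_mul (sq_nonneg _), mul_left_comm]
        have : ENNReal.ofReal (a i ^ 2) = ‖a i‖ₑ ^ 2 := by
          rw [Real.enorm_eq_ofReal_abs, ← ENNReal.ofReal_pow (abs_nonneg _), sq_abs]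
        rw [this]
        gcongr
        exact hX.variance_increment_le h𝒜 h𝒜m hm hdm (hC i)
      · intro i _ j _ hij
        exact ((hX.indep_increments n C hC hdisj).indepFun hij).comp
          (measurable_const_mul (a i)) (measurable_const_mul (a j))
    rw [eLpNorm_eq_lintegral_rpow_enorm_toReal two_ne_zero ENNReal.ofNat_ne_top,
      eLpNorm_eq_lintegral_rpow_enorm_toReal two_ne_zero ENNReal.ofNat_ne_top]
    simp only [ENNReal.toReal_ofNat, ENNReal.rpow_ofNat]
    rw [← ENNReal.mul_rpow_of_nonneg _ _ (by norm_num)]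
    refine ENNReal.rpow_le_rpow (le_trans (le_of_eq ?_) h1) (by norm_num)
    rw [hZL.ofReal_variance_eq]
    rfl
  have hsplit : Z = (fun _ => ∫ ω', Z ω' ∂P) + fun ω => Z ω - ∫ ω', Z ω' ∂P := by
    ext ω; simp
  calc eLpNorm Z 2 P ≤ eLpNorm (fun _ : Ω => ∫ ω', Z ω' ∂P) 2 P +
        eLpNorm (fun ω => Z ω - ∫ ω', Z ω' ∂P) 2 P := by
        conv_lhs => rw [hsplit]
        exact eLpNorm_add_le aestronglyMeasurable_const
          (hZL.1.sub aestronglyMeasurable_const) (by norm_num)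
    _ ≤ _ := by
        rw [eLpNorm_const _ two_ne_zero (IsProbabilityMeasure.ne_zero P)]
        simp only [measure_univ, ENNReal.one_rpow, mul_one]
        exact add_le_add hmean hvar

/-- The characteristic functional of the integral of a simple function factorizes over a member
of `𝒜` and its complement. -/
theorem IsSetIndexedLevy.integral_exp_simpleIntegral_eq_mul (h𝒜 : IsIndexingCollection 𝒜 mesh)
    (hX : IsSetIndexedLevy 𝒜 m P X) {φ : T → ℝ} (hφ : φ ∈ simpleFunctions 𝒜) {A : Set T}
    (hA : A ∈ 𝒜) :
    ∫ ω, Complex.exp (simpleIntegral 𝒜 X φ ω * Complex.I) ∂P =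
      (∫ ω, Complex.exp (simpleIntegral 𝒜 X (A.indicator φ) ω * Complex.I) ∂P) *
        ∫ ω, Complex.exp (simpleIntegral 𝒜 X (Aᶜ.indicator φ) ω * Complex.I) ∂P := by
  classical
  obtain ⟨n, C, a, hC, hdisj, rfl, hCA⟩ := exists_disjoint_representation h𝒜 hφ hA
  set ξ : Fin n → Ω → ℝ := fun i => simpleIntegral 𝒜 X (ind (C i)) with hξ
  have hξm : ∀ i, Measurable (ξ i) := fun i => hX.measurable_simpleIntegral h𝒜
    (ind_mem_simpleFunctions_of_mem_incrementClass h𝒜 (hC i))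
  have key : ∀ b : Fin n → ℝ,
      ∫ ω, Complex.exp (simpleIntegral 𝒜 X (∑ i, b i • ind (C i)) ω * Complex.I) ∂P =
        ∏ i, ∫ ω, Complex.exp ((b i * ξ i ω : ℝ) * Complex.I) ∂P := by
    intro b
    have h1 := (hX.indep_increments n C hC hdisj).integral_fun_prod_comp
      (f := fun i x => Complex.exp ((b i * x : ℝ) * Complex.I))
      (fun i => (hξm i).aemeasurable) (fun i => by fun_prop)
    refine Eq.trans (integral_congr_ae (Eventually.of_forall fun ω => ?_)) h1
    dsimp only
    rw [← Complex.exp_sum, ← Finset.sum_mul, simpleIntegral_sum_smul, ← Complex.ofReal_sum]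
    simp only [Finset.sum_apply, Pi.smul_apply, smul_eq_mul]
    rfl
  have hin : A.indicator (∑ i, a i • ind (C i)) =
      ∑ i, (if C i ⊆ A then a i else 0) • ind (C i) := by
    ext t
    simp only [Set.indicator_apply, Finset.sum_apply, Pi.smul_apply, smul_eq_mul]
    split_ifs with ht
    · refine Finset.sum_congr rfl fun i _ => ?_
      split_ifs with hi
      · rfl
      · have : t ∉ C i := fun h => Set.disjoint_left.mp ((hCA i).resolve_left hi) h ht
        simp [ind, this]
    · refine (Finset.sum_eq_zero fun i _ => ?_).symm
      split_ifs with hi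
      · have : t ∉ C i := fun h => ht (hi h)
        simp [ind, this]
      · simp
  have hout : Aᶜ.indicator (∑ i, a i • ind (C i)) =
      ∑ i, (if C i ⊆ A then 0 else a i) • ind (C i) := by
    rw [Set.indicator_compl, hin, ← Finset.sum_sub_distrib]
    refine Finset.sum_congr rfl fun i _ => ?_
    split_ifs <;> simp
  rw [hin, hout, key, key, key, ← Finset.prod_mul_distrib]
  refine Finset.prod_congr rfl fun i _ => ?_
  split_ifs <;> simp

end SimpleIntegral

/-! ### The stochastic integral and its characteristic functional -/

theorem enorm_setIntegral_exp_sub_le {Ω : Type*} [MeasurableSpace Ω] {P : Measure Ω}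
    [IsProbabilityMeasure P] {Z W : Ω → ℝ} (hZ : Measurable Z) (hW : Measurable W) (E : Set Ω) :
    ‖(∫ ω in E, Complex.exp (Z ω * Complex.I) ∂P) - ∫ ω in E, Complex.exp (W ω * Complex.I) ∂P‖ₑ ≤
      eLpNorm (Z - W) 2 P := by
  have hint : ∀ V : Ω → ℝ, Measurable V →
      Integrable (fun ω => Complex.exp (V ω * Complex.I)) (P.restrict E) := fun V hV =>
    Integrable.of_bound (by fun_prop) 1
      (Eventually.of_forall fun ω => (Complex.norm_exp_ofReal_mul_I _).le)
  rw [← integral_sub (hint Z hZ) (hint W hW)]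
  calc _ ≤ ∫⁻ ω in E, ‖Complex.exp (Z ω * Complex.I) - Complex.exp (W ω * Complex.I)‖ₑ ∂P :=
        enorm_integral_le_lintegral_enorm _
    _ ≤ ∫⁻ ω in E, ‖(Z - W) ω‖ₑ ∂P := by
        refine lintegral_mono fun ω => ?_
        have h1 : Complex.exp (Z ω * Complex.I) - Complex.exp (W ω * Complex.I) =
            Complex.exp (W ω * Complex.I) *
              (Complex.exp (Complex.I * ((Z - W) ω : ℝ)) - 1) := by
          rw [mul_sub, ← Complex.exp_add, Pi.sub_apply]
          push_cast
          ring_nf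
        have h2 : ‖Complex.exp (W ω * Complex.I)‖ₑ = 1 := by
          rw [← ofReal_norm, Complex.norm_exp_ofReal_mul_I, ENNReal.ofReal_one]
        rw [h1, enorm_mul, h2, one_mul]
        exact Real.enorm_exp_I_mul_ofReal_sub_one_le
    _ ≤ ∫⁻ ω, ‖(Z - W) ω‖ₑ ∂P := setLIntegral_le_lintegral _ _
    _ = eLpNorm (Z - W) 1 P := eLpNorm_one_eq_lintegral_enorm.symm
    _ ≤ eLpNorm (Z - W) 2 P := eLpNorm_le_eLpNorm_of_exponent_le (by norm_num)
        (hZ.sub hW).aestronglyMeasurable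

section StochasticIntegral

variable {T Ω : Type*} {𝒜 : Set (Set T)} {mesh : ℕ → Set (Set T)} [mT : MeasurableSpace T]
  {m : Measure T} [MeasurableSpace Ω] {P : Measure Ω} {X : Set T → Ω → ℝ} {g h : T → ℝ}
  {Z W : Ω → ℝ}

/-- `g` belongs to the closure in `L(X)` of the simple functions. -/
structure IsIntegrand (𝒜 : Set (Set T)) (m : Measure T) (P : Measure Ω) (X : Set T → Ω → ℝ)
    (g : T → ℝ) : Prop where
  measurable : Measurable g
  levyNorm_lt_top : levyNorm 𝒜 m P X g < ∞
  exists_simple : ∀ ε : ℝ≥0∞, 0 < ε → ∃ φ ∈ simpleFunctions 𝒜, levyNorm 𝒜 m P X (φ - g) < ε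

/-- The pair `(g, Z)` belongs to the closure of the graph of the integral of simple functions,
that is, `Z` is a version of `∫ g dX`. -/
structure IsIntegral (𝒜 : Set (Set T)) (m : Measure T) (P : Measure Ω) (X : Set T → Ω → ℝ)
    (g : T → ℝ) (Z : Ω → ℝ) : Prop where
  measurable_left : Measurable g
  measurable : Measurable Z
  exists_simple : ∀ ε : ℝ≥0∞, 0 < ε → ∃ φ ∈ simpleFunctions 𝒜, levyNorm 𝒜 m P X (φ - g) < ε ∧
    eLpNorm (simpleIntegral 𝒜 X φ - Z) 2 P < ε

theorem IsIntegral.isIntegrand (hZ : IsIntegral 𝒜 m P X g Z)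
    (hg : levyNorm 𝒜 m P X g < ∞) : IsIntegrand 𝒜 m P X g :=
  ⟨hZ.1, hg, fun ε hε => (hZ.exists_simple ε hε).imp fun _ h => ⟨h.1, h.2.1⟩⟩

variable [IsProbabilityMeasure P]

/-- A square-integrable set-indexed Lévy process `X` with reference measure `m` such that `d_m` is
compatible. -/
structure LevySetting (𝒜 : Set (Set T)) (mesh : ℕ → Set (Set T)) (m : Measure T) (P : Measure Ω)
    [IsProbabilityMeasure P] (X : Set T → Ω → ℝ) : Prop where
  isIndexingCollection : IsIndexingCollection 𝒜 mesh
  measurableSpace_eq : mT = MeasurableSpace.generateFrom 𝒜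
  measure_lt_top : ∀ A ∈ 𝒜, m A < ∞
  isCompatibleMetric : IsCompatibleMetric 𝒜 mesh (fun A A' => (m (A ∆ A')).toReal)
  isSetIndexedLevy : IsSetIndexedLevy 𝒜 m P X

namespace LevySetting

theorem measurableSet (S : LevySetting 𝒜 mesh m P X) : ∀ A ∈ 𝒜, MeasurableSet A := by
  intro A hA
  rw [S.measurableSpace_eq]
  exact MeasurableSpace.measurableSet_generateFrom hA

theorem measurable_simple (S : LevySetting 𝒜 mesh m P X) {φ : T → ℝ}
    (hφ : φ ∈ simpleFunctions 𝒜) : Measurable φ :=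
  measurable_of_mem_simpleFunctions S.measurableSet hφ

theorem measurable_simpleIntegral (S : LevySetting 𝒜 mesh m P X) {φ : T → ℝ}
    (hφ : φ ∈ simpleFunctions 𝒜) : Measurable (simpleIntegral 𝒜 X φ) :=
  S.isSetIndexedLevy.measurable_simpleIntegral S.isIndexingCollection hφ

theorem eLpNorm_simpleIntegral_le (S : LevySetting 𝒜 mesh m P X) {φ : T → ℝ}
    (hφ : φ ∈ simpleFunctions 𝒜) :
    eLpNorm (simpleIntegral 𝒜 X φ) 2 P ≤ levyNorm 𝒜 m P X φ :=
  S.isSetIndexedLevy.eLpNorm_simpleIntegral_le S.isIndexingCollection S.measurableSet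
    S.measure_lt_top S.isCompatibleMetric hφ

theorem isIntegral_simpleIntegral (S : LevySetting 𝒜 mesh m P X) {φ : T → ℝ}
    (hφ : φ ∈ simpleFunctions 𝒜) : IsIntegral 𝒜 m P X φ (simpleIntegral 𝒜 X φ) :=
  ⟨S.measurable_simple hφ, S.measurable_simpleIntegral hφ, fun ε hε =>
    ⟨φ, hφ, by simpa [levyNorm, weightedNorm] using hε, by simpa using hε⟩⟩

theorem isIntegral_zero (S : LevySetting 𝒜 mesh m P X) : IsIntegral 𝒜 m P X 0 0 := by
  have := S.isIntegral_simpleIntegral (zero_mem (simpleFunctions 𝒜))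
  rwa [simpleIntegral_zero] at this

theorem isIntegral_add (S : LevySetting 𝒜 mesh m P X) (hZ : IsIntegral 𝒜 m P X g Z)
    (hW : IsIntegral 𝒜 m P X h W) : IsIntegral 𝒜 m P X (g + h) (Z + W) := by
  refine ⟨hZ.1.add hW.1, hZ.2.add hW.2, fun ε hε => ?_⟩
  obtain ⟨φ, hφ, h1, h2⟩ := hZ.exists_simple _ (ENNReal.half_pos hε.ne')
  obtain ⟨ψ, hψ, h3, h4⟩ := hW.exists_simple _ (ENNReal.half_pos hε.ne')
  refine ⟨φ + ψ, add_mem hφ hψ, ?_, ?_⟩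
  · rw [add_sub_add_comm]
    refine (weightedNorm_add_le ((S.measurable_simple hφ).sub hZ.1)
      ((S.measurable_simple hψ).sub hW.1)).trans_lt ?_
    rw [← ENNReal.add_halves ε]
    exact ENNReal.add_lt_add h1 h3
  · rw [simpleIntegral_add, add_sub_add_comm]
    refine (eLpNorm_add_le ((S.measurable_simpleIntegral hφ).sub hZ.2).aestronglyMeasurable
      ((S.measurable_simpleIntegral hψ).sub hW.2).aestronglyMeasurable (by norm_num)).trans_lt ?_
    rw [← ENNReal.add_halves ε]
    exact ENNReal.add_lt_add h2 h4

theorem isIntegral_smul (S : LevySetting 𝒜 mesh m P X) (c : ℝ) (hZ : IsIntegral 𝒜 m P X g Z) :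
    IsIntegral 𝒜 m P X (c • g) (c • Z) := by
  rcases eq_or_ne c 0 with rfl | hc
  · simpa using S.isIntegral_zero
  refine ⟨hZ.1.const_smul c, hZ.2.const_smul c, fun ε hε => ?_⟩
  have hc0 : ‖c‖ₑ ≠ 0 := by simpa using hc
  obtain ⟨φ, hφ, h1, h2⟩ := hZ.exists_simple (ε / ‖c‖ₑ) (ENNReal.div_pos hε.ne' enorm_ne_top)
  rw [ENNReal.lt_div_iff_mul_lt (Or.inl hc0) (Or.inl enorm_ne_top), mul_comm] at h1 h2
  refine ⟨c • φ, Submodule.smul_mem _ c hφ, ?_, ?_⟩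
  · rw [← smul_sub, levyNorm, weightedNorm_smul]
    exact h1
  · rw [simpleIntegral_smul, ← smul_sub, eLpNorm_const_smul]
    exact h2

theorem isIntegral_sub (S : LevySetting 𝒜 mesh m P X) (hZ : IsIntegral 𝒜 m P X g Z)
    (hW : IsIntegral 𝒜 m P X h W) : IsIntegral 𝒜 m P X (g - h) (Z - W) := by
  have := S.isIntegral_add hZ (S.isIntegral_smul (-1) hW)
  simpa [sub_eq_add_neg] using this

theorem isIntegral_sum (S : LevySetting 𝒜 mesh m P X) {ι : Type*} (s : Finset ι) (t : ι → ℝ)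
    {G : ι → T → ℝ} {ξ : ι → Ω → ℝ} (hG : ∀ j, IsIntegral 𝒜 m P X (G j) (ξ j)) :
    IsIntegral 𝒜 m P X (∑ j ∈ s, t j • G j) (∑ j ∈ s, t j • ξ j) := by
  classical
  induction s using Finset.induction_on with
  | empty => simpa using S.isIntegral_zero
  | insert j s hj ih =>
    rw [Finset.sum_insert hj, Finset.sum_insert hj]
    exact S.isIntegral_add (S.isIntegral_smul _ (hG j)) ih

theorem eLpNorm_le (S : LevySetting 𝒜 mesh m P X) (hZ : IsIntegral 𝒜 m P X g Z) :
    eLpNorm Z 2 P ≤ levyNorm 𝒜 m P X g := by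
  refine ENNReal.le_of_forall_pos_le_add fun ε hε _ => ?_
  have hε' : (0 : ℝ≥0∞) < ε := by exact_mod_cast hε
  obtain ⟨φ, hφ, h1, h2⟩ := hZ.exists_simple _ (ENNReal.half_pos hε'.ne')
  have hφm := S.measurable_simple hφ
  have hJm := S.measurable_simpleIntegral hφ
  calc eLpNorm Z 2 P = eLpNorm (simpleIntegral 𝒜 X φ + (Z - simpleIntegral 𝒜 X φ)) 2 P := by
        rw [add_sub_cancel]
    _ ≤ eLpNorm (simpleIntegral 𝒜 X φ) 2 P + eLpNorm (Z - simpleIntegral 𝒜 X φ) 2 P :=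
        eLpNorm_add_le hJm.aestronglyMeasurable (hZ.2.sub hJm).aestronglyMeasurable (by norm_num)
    _ ≤ levyNorm 𝒜 m P X (g + (φ - g)) + (ε : ℝ≥0∞) / 2 := by
        rw [add_sub_cancel, eLpNorm_sub_comm]
        exact add_le_add (S.eLpNorm_simpleIntegral_le hφ) h2.le
    _ ≤ levyNorm 𝒜 m P X g + (ε : ℝ≥0∞) / 2 + (ε : ℝ≥0∞) / 2 := by
        gcongr
        exact (weightedNorm_add_le hZ.1 (hφm.sub hZ.1)).trans (add_le_add le_rfl h1.le)
    _ = levyNorm 𝒜 m P X g + ε := by rw [add_assoc, ENNReal.add_halves]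

theorem ae_eq_of_isIntegral (S : LevySetting 𝒜 mesh m P X) (hZ : IsIntegral 𝒜 m P X g Z)
    (hW : IsIntegral 𝒜 m P X g W) : Z =ᵐ[P] W := by
  have h1 := S.eLpNorm_le (S.isIntegral_sub hZ hW)
  have h2 : levyNorm 𝒜 m P X (g - g) = 0 := by simp [levyNorm, weightedNorm]
  rw [h2, nonpos_iff_eq_zero, eLpNorm_eq_zero_iff (hZ.2.sub hW.2).aestronglyMeasurable
    two_ne_zero] at h1
  filter_upwards [h1] with ω hω
  exact sub_eq_zero.mp hω

/-- By completeness of `L²(Ω)`, every function in the closure of the simple functions has an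
integral. -/
theorem exists_isIntegral (S : LevySetting 𝒜 mesh m P X) (hg : IsIntegrand 𝒜 m P X g) :
    ∃ Z, IsIntegral 𝒜 m P X g Z := by
  have hpos : ∀ n : ℕ, (0 : ℝ≥0∞) < 2⁻¹ ^ (n + 1) := fun n =>
    ENNReal.pow_pos (by simp) _
  choose φ hφ hφg using fun n : ℕ => hg.exists_simple _ (hpos n)
  have hφm := fun n => S.measurable_simple (hφ n)
  have htend : Tendsto (fun n : ℕ => (2⁻¹ : ℝ≥0∞) ^ n) atTop (𝓝 0) :=
    ENNReal.tendsto_pow_atTop_nhds_zero_of_lt_one (by simp)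
  obtain ⟨Z, hZ, hlim⟩ := Lp.cauchy_complete_eLpNorm (μ := P) (p := 2) (by norm_num)
    (f := fun n => simpleIntegral 𝒜 X (φ n))
    (fun n => S.isSetIndexedLevy.memLp_simpleIntegral S.isIndexingCollection (hφ n))
    (B := fun n => 2⁻¹ ^ n) (by rw [ENNReal.tsum_geometric]; simp) (by
      intro N n k hn hk
      rw [← simpleIntegral_sub]
      have hle : ∀ j, N ≤ j → levyNorm 𝒜 m P X (φ j - g) < 2⁻¹ ^ (N + 1) := fun j hj =>
        (hφg j).trans_le (pow_le_pow_right_of_le_one' (by simp) (by omega))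
      calc _ ≤ levyNorm 𝒜 m P X (φ n - φ k) :=
            S.eLpNorm_simpleIntegral_le (sub_mem (hφ n) (hφ k))
        _ ≤ levyNorm 𝒜 m P X (φ n - g) + levyNorm 𝒜 m P X (g - φ k) :=
            weightedNorm_sub_le (hφm n) hg.measurable (hφm k)
        _ < 2⁻¹ ^ (N + 1) + 2⁻¹ ^ (N + 1) := by
            rw [levyNorm, levyNorm, weightedNorm_sub_comm g]
            exact ENNReal.add_lt_add (hle n hn) (hle k hk)
        _ = 2⁻¹ ^ N := by
            rw [pow_succ, ← mul_add, ENNReal.inv_two_add_inv_two, mul_one])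
  refine ⟨hZ.1.mk Z, hg.measurable, hZ.1.stronglyMeasurable_mk.measurable, fun ε hε => ?_⟩
  obtain ⟨n, h1, h2⟩ := ((hlim.eventually_lt_const hε).and
    ((htend.comp (tendsto_add_atTop_nat 1)).eventually_lt_const hε)).exists
  refine ⟨φ n, hφ n, (hφg n).trans h2, ?_⟩
  rwa [eLpNorm_congr_ae ((ae_eq_refl _).sub hZ.1.ae_eq_mk.symm)]

end LevySetting

open Classical in
/-- A version of the stochastic integral `∫ g dX` of an integrand `g`. -/
noncomputable def stochInt (𝒜 : Set (Set T)) (m : Measure T) (P : Measure Ω)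
    (X : Set T → Ω → ℝ) (g : T → ℝ) : Ω → ℝ :=
  if H : ∃ Z, IsIntegral 𝒜 m P X g Z then H.choose else 0

/-- The characteristic functional `g ↦ 𝔼[exp (i ∫ g dX)]`. -/
noncomputable def charFunctional (𝒜 : Set (Set T)) (m : Measure T) (P : Measure Ω)
    (X : Set T → Ω → ℝ) (g : T → ℝ) : ℂ :=
  ∫ ω, Complex.exp (stochInt 𝒜 m P X g ω * Complex.I) ∂P

namespace LevySetting

theorem isIntegral_stochInt (S : LevySetting 𝒜 mesh m P X) (hg : IsIntegrand 𝒜 m P X g) :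
    IsIntegral 𝒜 m P X g (stochInt 𝒜 m P X g) := by
  have H := S.exists_isIntegral hg
  rw [stochInt, dif_pos H]
  exact H.choose_spec

theorem integral_exp_eq_charFunctional (S : LevySetting 𝒜 mesh m P X)
    (hZ : IsIntegral 𝒜 m P X g Z) :
    ∫ ω, Complex.exp (Z ω * Complex.I) ∂P = charFunctional 𝒜 m P X g := by
  have H : ∃ Z, IsIntegral 𝒜 m P X g Z := ⟨Z, hZ⟩
  have h2 : IsIntegral 𝒜 m P X g (stochInt 𝒜 m P X g) := by
    rw [stochInt, dif_pos H]
    exact H.choose_spec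
  refine integral_congr_ae ?_
  filter_upwards [S.ae_eq_of_isIntegral hZ h2] with ω hω
  rw [hω]

theorem isIntegrand_simple (S : LevySetting 𝒜 mesh m P X) {φ : T → ℝ}
    (hφ : φ ∈ simpleFunctions 𝒜) (h : levyNorm 𝒜 m P X φ < ∞) : IsIntegrand 𝒜 m P X φ :=
  ⟨S.measurable_simple hφ, h, fun ε hε =>
    ⟨φ, hφ, by simpa [levyNorm, weightedNorm] using hε⟩⟩

theorem isIntegrand_zero (S : LevySetting 𝒜 mesh m P X) : IsIntegrand 𝒜 m P X 0 :=
  S.isIntegrand_simple (zero_mem _) (by simp [levyNorm, weightedNorm])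

theorem isIntegrand_of_forall (S : LevySetting 𝒜 mesh m P X) (hg : Measurable g)
    (h : ∀ ε : ℝ≥0∞, 0 < ε → ∃ g', IsIntegrand 𝒜 m P X g' ∧ levyNorm 𝒜 m P X (g' - g) < ε) :
    IsIntegrand 𝒜 m P X g := by
  refine ⟨hg, ?_, fun ε hε => ?_⟩
  · obtain ⟨g', hg', h1⟩ := h 1 one_pos
    calc levyNorm 𝒜 m P X g = levyNorm 𝒜 m P X (g' + (g - g')) := by rw [add_sub_cancel]
      _ ≤ levyNorm 𝒜 m P X g' + levyNorm 𝒜 m P X (g - g') :=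
        weightedNorm_add_le hg'.measurable (hg.sub hg'.measurable)
      _ < ∞ := by
        rw [levyNorm, levyNorm, weightedNorm_sub_comm g]
        exact ENNReal.add_lt_top.mpr ⟨hg'.levyNorm_lt_top, h1.trans ENNReal.one_lt_top⟩
  · obtain ⟨g', hg', h1⟩ := h _ (ENNReal.half_pos hε.ne')
    obtain ⟨φ, hφ, h2⟩ := hg'.exists_simple _ (ENNReal.half_pos hε.ne')
    refine ⟨φ, hφ, (weightedNorm_sub_le (S.measurable_simple hφ) hg'.measurable hg).trans_lt ?_⟩
    rw [← ENNReal.add_halves ε]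
    exact ENNReal.add_lt_add h2 h1

theorem isIntegrand_add (S : LevySetting 𝒜 mesh m P X) (hg : IsIntegrand 𝒜 m P X g)
    (hh : IsIntegrand 𝒜 m P X h) : IsIntegrand 𝒜 m P X (g + h) :=
  IsIntegral.isIntegrand (S.isIntegral_add (S.isIntegral_stochInt hg) (S.isIntegral_stochInt hh))
    ((weightedNorm_add_le hg.1 hh.1).trans_lt (ENNReal.add_lt_top.mpr ⟨hg.2, hh.2⟩))

theorem isIntegrand_smul (S : LevySetting 𝒜 mesh m P X) (c : ℝ) (hg : IsIntegrand 𝒜 m P X g) :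
    IsIntegrand 𝒜 m P X (c • g) :=
  IsIntegral.isIntegrand (S.isIntegral_smul c (S.isIntegral_stochInt hg)) (by
    rw [levyNorm, weightedNorm_smul]
    exact ENNReal.mul_lt_top enorm_lt_top hg.2)

theorem isIntegrand_sub (S : LevySetting 𝒜 mesh m P X) (hg : IsIntegrand 𝒜 m P X g)
    (hh : IsIntegrand 𝒜 m P X h) : IsIntegrand 𝒜 m P X (g - h) := by
  simpa [sub_eq_add_neg] using S.isIntegrand_add hg (S.isIntegrand_smul (-1) hh)

theorem isIntegrand_sum (S : LevySetting 𝒜 mesh m P X) {ι : Type*} (s : Finset ι) (t : ι → ℝ)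
    {G : ι → T → ℝ} (hG : ∀ j, IsIntegrand 𝒜 m P X (G j)) :
    IsIntegrand 𝒜 m P X (∑ j ∈ s, t j • G j) := by
  classical
  induction s using Finset.induction_on with
  | empty => simpa using S.isIntegrand_zero
  | insert j s hj ih =>
    rw [Finset.sum_insert hj]
    exact S.isIntegrand_add (S.isIntegrand_smul _ (hG j)) ih

theorem enorm_charFunctional_sub_le (S : LevySetting 𝒜 mesh m P X)
    (hg : IsIntegrand 𝒜 m P X g) (hh : IsIntegrand 𝒜 m P X h) :
    ‖charFunctional 𝒜 m P X g - charFunctional 𝒜 m P X h‖ₑ ≤ levyNorm 𝒜 m P X (g - h) := by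
  have h1 := S.isIntegral_stochInt hg
  have h2 := S.isIntegral_stochInt hh
  have h3 := enorm_setIntegral_exp_sub_le (P := P) h1.measurable h2.measurable Set.univ
  rw [Measure.restrict_univ] at h3
  exact h3.trans (S.eLpNorm_le (S.isIntegral_sub h1 h2))

theorem tendsto_charFunctional (S : LevySetting 𝒜 mesh m P X) {G : ℕ → T → ℝ}
    (hG : ∀ n, IsIntegrand 𝒜 m P X (G n)) (hg : IsIntegrand 𝒜 m P X g)
    (h : Tendsto (fun n => levyNorm 𝒜 m P X (G n - g)) atTop (𝓝 0)) :
    Tendsto (fun n => charFunctional 𝒜 m P X (G n)) atTop (𝓝 (charFunctional 𝒜 m P X g)) := by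
  rw [tendsto_iff_edist_tendsto_0]
  refine tendsto_of_tendsto_of_tendsto_of_le_of_le tendsto_const_nhds h (fun _ => zero_le)
    (fun n => ?_)
  rw [edist_eq_enorm_sub]
  exact S.enorm_charFunctional_sub_le (hG n) hg

theorem charFunctional_zero (S : LevySetting 𝒜 mesh m P X) : charFunctional 𝒜 m P X 0 = 1 := by
  rw [← S.integral_exp_eq_charFunctional S.isIntegral_zero]
  simp

end LevySetting

/-! ### Independence of integrals over complementary sets -/

/-- Integrands can be restricted to `U`, and the integrals over `U` and over its complement are
independent, as expressed by the characteristic functional. -/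
def Splits (𝒜 : Set (Set T)) (m : Measure T) (P : Measure Ω) (X : Set T → Ω → ℝ) (U : Set T) :
    Prop :=
  ∀ g, IsIntegrand 𝒜 m P X g → IsIntegrand 𝒜 m P X (U.indicator g) ∧
    charFunctional 𝒜 m P X g =
      charFunctional 𝒜 m P X (U.indicator g) * charFunctional 𝒜 m P X (Uᶜ.indicator g)

namespace LevySetting

theorem splits_empty (S : LevySetting 𝒜 mesh m P X) : Splits 𝒜 m P X ∅ := by
  intro g hg
  have h0 : (∅ : Set T).indicator g = 0 := Set.indicator_empty g
  rw [h0]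
  refine ⟨S.isIntegrand_zero, ?_⟩
  rw [Set.compl_empty, Set.indicator_univ, S.charFunctional_zero, one_mul]

/-- The factorization passes from simple functions to their limits. -/
theorem splits_of_mem (S : LevySetting 𝒜 mesh m P X) {A : Set T} (hA : A ∈ 𝒜) :
    Splits 𝒜 m P X A := by
  have hAm := S.measurableSet A hA
  have hind : ∀ g, IsIntegrand 𝒜 m P X g → IsIntegrand 𝒜 m P X (A.indicator g) := fun g hg =>
    ⟨hg.1.indicator hAm, (weightedNorm_indicator_le g A).trans_lt hg.2, fun ε hε => by
      obtain ⟨φ, hφ, h1⟩ := hg.exists_simple ε hε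
      refine ⟨A.indicator φ, indicator_mem_simpleFunctions S.isIndexingCollection hA hφ, ?_⟩
      rw [← Set.indicator_sub']
      exact (weightedNorm_indicator_le _ A).trans_lt h1⟩
  have hindc : ∀ g, IsIntegrand 𝒜 m P X g → IsIntegrand 𝒜 m P X (Aᶜ.indicator g) := fun g hg => by
    rw [Set.indicator_compl]
    exact S.isIntegrand_sub hg (hind g hg)
  refine fun g hg => ⟨hind g hg, ?_⟩
  have hpos : ∀ n : ℕ, (0 : ℝ≥0∞) < 2⁻¹ ^ n := fun n => ENNReal.pow_pos (by simp) _
  choose φ hφ hφg using fun n : ℕ => hg.exists_simple _ (hpos n)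
  have htend : Tendsto (fun n : ℕ => (2⁻¹ : ℝ≥0∞) ^ n) atTop (𝓝 0) :=
    ENNReal.tendsto_pow_atTop_nhds_zero_of_lt_one (by simp)
  have hlim : Tendsto (fun n => levyNorm 𝒜 m P X (φ n - g)) atTop (𝓝 0) :=
    tendsto_of_tendsto_of_tendsto_of_le_of_le tendsto_const_nhds htend (fun _ => zero_le)
      fun n => (hφg n).le
  have hφI : ∀ n, IsIntegrand 𝒜 m P X (φ n) := fun n => S.isIntegrand_simple (hφ n) (by
    calc levyNorm 𝒜 m P X (φ n) = levyNorm 𝒜 m P X (φ n - g + g) := by rw [sub_add_cancel]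
      _ ≤ levyNorm 𝒜 m P X (φ n - g) + levyNorm 𝒜 m P X g :=
        weightedNorm_add_le ((S.measurable_simple (hφ n)).sub hg.1) hg.1
      _ < ∞ := ENNReal.add_lt_top.mpr ⟨(hφg n).trans_le le_top, hg.2⟩)
  have hres : ∀ U : Set T, Tendsto (fun n => levyNorm 𝒜 m P X (U.indicator (φ n) - U.indicator g))
      atTop (𝓝 0) := fun U =>
    tendsto_of_tendsto_of_tendsto_of_le_of_le tendsto_const_nhds hlim (fun _ => zero_le)
      fun n => by
        dsimp only
        rw [← Set.indicator_sub']
        exact weightedNorm_indicator_le _ U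
  refine tendsto_nhds_unique (S.tendsto_charFunctional hφI hg hlim) ?_
  have h1 := (S.tendsto_charFunctional (fun n => hind _ (hφI n)) (hind g hg) (hres A)).mul
    (S.tendsto_charFunctional (fun n => hindc _ (hφI n)) (hindc g hg) (hres Aᶜ))
  refine h1.congr fun n => ?_
  rw [← S.integral_exp_eq_charFunctional (S.isIntegral_simpleIntegral (hφ n)),
    ← S.integral_exp_eq_charFunctional (S.isIntegral_simpleIntegral
      (indicator_mem_simpleFunctions S.isIndexingCollection hA (hφ n))),
    ← S.integral_exp_eq_charFunctional (S.isIntegral_simpleIntegral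
      (indicator_compl_mem_simpleFunctions S.isIndexingCollection hA (hφ n)))]
  exact (S.isSetIndexedLevy.integral_exp_simpleIntegral_eq_mul S.isIndexingCollection
    (hφ n) hA).symm

theorem splits_compl (S : LevySetting 𝒜 mesh m P X) {U : Set T} (hU : Splits 𝒜 m P X U) :
    Splits 𝒜 m P X Uᶜ := by
  intro g hg
  obtain ⟨h1, h2⟩ := hU g hg
  refine ⟨?_, ?_⟩
  · rw [Set.indicator_compl]
    exact S.isIntegrand_sub hg h1
  · rw [compl_compl, h2, mul_comm]

/-- Split off `U` first, and then split `g 1_{Uᶜ}` along `V` and `g 1_{U ∪ V}` along `U`. -/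
theorem splits_union (S : LevySetting 𝒜 mesh m P X) {U V : Set T} (hU : Splits 𝒜 m P X U)
    (hV : Splits 𝒜 m P X V) (hUV : Disjoint U V) : Splits 𝒜 m P X (U ∪ V) := by
  intro g hg
  obtain ⟨hgU, hsU⟩ := hU g hg
  obtain ⟨hgV, -⟩ := hV g hg
  have hgUc := (S.splits_compl hU g hg).1
  obtain ⟨-, hsV⟩ := hV _ hgUc
  have hsum : (U ∪ V).indicator g = U.indicator g + V.indicator g :=
    Set.indicator_union_of_disjoint hUV g
  have hgUV : IsIntegrand 𝒜 m P X ((U ∪ V).indicator g) := by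
    rw [hsum]
    exact S.isIntegrand_add hgU hgV
  obtain ⟨-, hs⟩ := hU _ hgUV
  have e1 : U ∩ (U ∪ V) = U := Set.inter_eq_left.mpr Set.subset_union_left
  have e2 : Uᶜ ∩ (U ∪ V) = V := by
    ext t
    simp only [Set.mem_inter_iff, Set.mem_compl_iff, Set.mem_union]
    have := fun h : t ∈ U => Set.disjoint_left.mp hUV h
    tauto
  have e3 : V ∩ Uᶜ = V := by
    ext t
    simp only [Set.mem_inter_iff, Set.mem_compl_iff]
    have := fun h : t ∈ U => Set.disjoint_left.mp hUV h
    tauto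
  have e4 : Vᶜ ∩ Uᶜ = (U ∪ V)ᶜ := by
    rw [Set.compl_union, Set.inter_comm]
  rw [Set.indicator_indicator, Set.indicator_indicator, e1, e2] at hs
  rw [Set.indicator_indicator, Set.indicator_indicator, e3, e4] at hsV
  refine ⟨hgUV, ?_⟩
  rw [hsU, hsV, hs, mul_assoc]

theorem splits_iUnion (S : LevySetting 𝒜 mesh m P X) {U : ℕ → Set T}
    (hUm : ∀ n, MeasurableSet (U n)) (hdisj : Pairwise (fun i j => Disjoint (U i) (U j)))
    (hU : ∀ n, Splits 𝒜 m P X (U n)) : Splits 𝒜 m P X (⋃ n, U n) := by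
  set V : ℕ → Set T := fun n => ⋃ i ∈ Finset.range n, U i with hVdef
  have hVm : ∀ n, MeasurableSet (V n) := fun n => Finset.measurableSet_biUnion _ fun i _ => hUm i
  have hV : ∀ n, Splits 𝒜 m P X (V n) := by
    intro n
    induction n with
    | zero => simpa [hVdef] using S.splits_empty
    | succ n ih =>
      have : V (n + 1) = V n ∪ U n := by
        simp only [hVdef, Finset.range_add_one, Finset.set_biUnion_insert, Set.union_comm]
      rw [this]
      refine S.splits_union ih (hU n) ?_
      rw [hVdef, Set.disjoint_iUnion₂_left]
      exact fun i hi => hdisj (Finset.mem_range.mp hi).ne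
  have hVU : ∀ n, V n ⊆ ⋃ n, U n := fun n => Set.iUnion₂_subset fun i _ => Set.subset_iUnion U i
  have hUU : MeasurableSet (⋃ n, U n) := MeasurableSet.iUnion hUm
  intro g hg
  have hD : Tendsto (fun n => levyNorm 𝒜 m P X (((⋃ n, U n) \ V n).indicator g)) atTop (𝓝 0) := by
    refine tendsto_weightedNorm_indicator_of_antitone hg.2 (fun n => hUU.diff (hVm n)) ?_ ?_
    · intro n k hnk
      refine Set.sdiff_subset_sdiff_right (Set.iUnion₂_subset fun i hi => ?_)
      exact Set.subset_biUnion_of_mem (u := U)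
        (Finset.mem_coe.mpr (Finset.mem_range.mpr ((Finset.mem_range.mp hi).trans_le hnk)))
    · rw [Set.eq_empty_iff_forall_notMem]
      intro t ht
      rw [Set.mem_iInter] at ht
      obtain ⟨i, hi⟩ := Set.mem_iUnion.mp (ht 0).1
      exact (ht (i + 1)).2 (Set.mem_biUnion (Finset.mem_coe.mpr (Finset.self_mem_range_succ i)) hi)
  have hdiff : ∀ n, (⋃ n, U n).indicator g - (V n).indicator g =
      ((⋃ n, U n) \ V n).indicator g := fun n => (Set.indicator_sdiff (hVU n) g).symm
  have hlim : Tendsto (fun n => levyNorm 𝒜 m P X ((V n).indicator g - (⋃ n, U n).indicator g))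
      atTop (𝓝 0) := by
    refine hD.congr fun n => ?_
    rw [← hdiff, levyNorm, weightedNorm_sub_comm]
  have hlimc : Tendsto (fun n => levyNorm 𝒜 m P X
      ((V n)ᶜ.indicator g - (⋃ n, U n)ᶜ.indicator g)) atTop (𝓝 0) := by
    refine hD.congr fun n => ?_
    rw [← hdiff, Set.indicator_compl, Set.indicator_compl, sub_sub_sub_cancel_left]
  have hI : IsIntegrand 𝒜 m P X ((⋃ n, U n).indicator g) := by
    refine S.isIntegrand_of_forall (hg.1.indicator hUU) fun ε hε => ?_
    obtain ⟨n, hn⟩ := (hlim.eventually_lt_const hε).exists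
    exact ⟨_, (hV n g hg).1, hn⟩
  have hIc : IsIntegrand 𝒜 m P X ((⋃ n, U n)ᶜ.indicator g) := by
    rw [Set.indicator_compl]
    exact S.isIntegrand_sub hg hI
  refine ⟨hI, tendsto_nhds_unique tendsto_const_nhds
    (((S.tendsto_charFunctional (fun n => (hV n g hg).1) hI hlim).mul
      (S.tendsto_charFunctional (fun n => (S.splits_compl (hV n) g hg).1) hIc hlimc)).congr
      fun n => ?_)⟩
  exact (hV n g hg).2.symm

/-- Every measurable set splits integrands, by the π-λ theorem. -/
theorem splits (S : LevySetting 𝒜 mesh m P X) {U : Set T} (hU : MeasurableSet U) :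
    Splits 𝒜 m P X U := by
  induction U, hU using MeasurableSpace.induction_on_inter S.measurableSpace_eq
    S.isIndexingCollection.isPiSystem with
  | empty => exact S.splits_empty
  | basic A hA => exact S.splits_of_mem hA
  | compl U _ ih => exact S.splits_compl ih
  | iUnion U hdisj hUm ih => exact S.splits_iUnion hUm hdisj ih

end LevySetting

end StochasticIntegral

/-! ### The zero-one law -/

/-- If the characteristic functions of `Z + H` and `Z - H` factorize, then `exp (i Z)` and
`cos (H + θ)` are uncorrelated. -/
theorem integral_exp_mul_cos_eq {Ω : Type*} [MeasurableSpace Ω] {P : Measure Ω}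
    [IsProbabilityMeasure P] {Z H : Ω → ℝ} (hZ : Measurable Z) (hH : Measurable H)
    (hadd : ∫ ω, Complex.exp ((Z + H) ω * Complex.I) ∂P =
      (∫ ω, Complex.exp (Z ω * Complex.I) ∂P) * ∫ ω, Complex.exp (H ω * Complex.I) ∂P)
    (hsub : ∫ ω, Complex.exp ((Z - H) ω * Complex.I) ∂P =
      (∫ ω, Complex.exp (Z ω * Complex.I) ∂P) * ∫ ω, Complex.exp ((-H) ω * Complex.I) ∂P)
    (θ : ℝ) :
    ∫ ω, Complex.exp (Z ω * Complex.I) * (Real.cos (H ω + θ) : ℂ) ∂P =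
      (∫ ω, Complex.exp (Z ω * Complex.I) ∂P) * (∫ ω, Real.cos (H ω + θ) ∂P : ℝ) := by
  have hint : ∀ V : Ω → ℝ, Measurable V →
      Integrable (fun ω => Complex.exp (V ω * Complex.I)) P := fun V hV =>
    Integrable.of_bound (by fun_prop) 1
      (Eventually.of_forall fun ω => (Complex.norm_exp_ofReal_mul_I _).le)
  have h1 : ∀ ω, Complex.exp (Z ω * Complex.I) * (Real.cos (H ω + θ) : ℂ) =
      Complex.exp (θ * Complex.I) / 2 * Complex.exp ((Z + H) ω * Complex.I) +
      Complex.exp (-θ * Complex.I) / 2 * Complex.exp ((Z - H) ω * Complex.I) := by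
    intro ω
    have e1 : ((Z + H) ω : ℂ) * Complex.I = Z ω * Complex.I + H ω * Complex.I := by
      simp [add_mul]
    have e2 : ((Z - H) ω : ℂ) * Complex.I = Z ω * Complex.I + -(H ω * Complex.I) := by
      rw [Pi.sub_apply, Complex.ofReal_sub, sub_mul, sub_eq_add_neg]
    have e3 : ((H ω + θ : ℝ) : ℂ) * Complex.I = H ω * Complex.I + θ * Complex.I := by
      push_cast; ring
    have e4 : -((H ω + θ : ℝ) : ℂ) * Complex.I = -(H ω * Complex.I) + -θ * Complex.I := by
      push_cast; ring
    rw [e1, e2, Complex.ofReal_cos, Complex.cos, e3, e4]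
    simp only [Complex.exp_add]
    ring
  have h2 : ∀ ω, (Real.cos (H ω + θ) : ℂ) =
      Complex.exp (θ * Complex.I) / 2 * Complex.exp (H ω * Complex.I) +
      Complex.exp (-θ * Complex.I) / 2 * Complex.exp ((-H) ω * Complex.I) := by
    intro ω
    have e3 : ((H ω + θ : ℝ) : ℂ) * Complex.I = H ω * Complex.I + θ * Complex.I := by
      push_cast; ring
    have e4 : -((H ω + θ : ℝ) : ℂ) * Complex.I = ((-H) ω : ℝ) * Complex.I + -θ * Complex.I := by
      simp only [Pi.neg_apply]; push_cast; ring
    rw [Complex.ofReal_cos, Complex.cos, e3, e4]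
    simp only [Complex.exp_add]
    ring
  rw [← integral_complex_ofReal]
  simp only [h1]
  simp only [h2]
  rw [integral_add ((hint _ (hZ.add hH)).const_mul _) ((hint _ (hZ.sub hH)).const_mul _),
    integral_add ((hint _ hH).const_mul _) ((hint _ hH.neg).const_mul _)]
  simp only [integral_const_mul]
  rw [hadd, hsub]
  ring

section ZeroOne

variable {T Ω : Type*} {𝒜 : Set (Set T)} {mesh : ℕ → Set (Set T)} [mT : MeasurableSpace T]
  {m : Measure T} [MeasurableSpace Ω] {P : Measure Ω} {X : Set T → Ω → ℝ}
  {g h : T → ℝ}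

theorem IsStochasticIntegral.isIntegral (hg : Measurable g)
    {Z : Ω → ℝ} (hZ : IsStochasticIntegral 𝒜 m P X g Z) : IsIntegral 𝒜 m P X g Z := by
  obtain ⟨hZm, φ, hφ, h1, h2⟩ := hZ
  have h3 : Tendsto (fun n => levyNorm 𝒜 m P X (φ n - g)) atTop (𝓝 0) := by
    have := ENNReal.Tendsto.const_mul (a := 2) h1 (Or.inr ENNReal.ofNat_ne_top)
    rw [mul_zero] at this
    exact tendsto_of_tendsto_of_tendsto_of_le_of_le tendsto_const_nhds this (fun _ => zero_le)
      fun n => levyNorm_le_two_mul_normLX _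
  refine ⟨hg, hZm, fun ε hε => ?_⟩
  obtain ⟨n, h4, h5⟩ := ((h3.eventually_lt_const hε).and (h2.eventually_lt_const hε)).exists
  exact ⟨φ n, hφ n, h4, h5⟩

variable [IsProbabilityMeasure P]

namespace LevySetting

theorem charFunctional_add (S : LevySetting 𝒜 mesh m P X) {W : Set T} (hW : MeasurableSet W)
    (hg : IsIntegrand 𝒜 m P X g) (hh : IsIntegrand 𝒜 m P X h) (hgW : W.indicator g = g)
    (hhW : Wᶜ.indicator h = h) :
    charFunctional 𝒜 m P X (g + h) = charFunctional 𝒜 m P X g * charFunctional 𝒜 m P X h := by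
  have h1 : W.indicator (g + h) = g := by
    rw [Set.indicator_add', hgW, ← hhW, Set.indicator_indicator, Set.inter_compl_self,
      Set.indicator_empty]
    exact add_zero g
  have h2 : Wᶜ.indicator (g + h) = h := by
    rw [Set.indicator_add', hhW, ← hgW, Set.indicator_indicator, Set.compl_inter_self,
      Set.indicator_empty]
    exact zero_add h
  have := (S.splits hW _ (S.isIntegrand_add hg hh)).2
  rwa [h1, h2] at this

/-- Events generated by integrals over `W` are independent of integrals over the complement. -/
theorem setIntegral_exp_stochInt_eq (S : LevySetting 𝒜 mesh m P X) {W : Set T}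
    (hW : MeasurableSet W) {ι : Type*} {G : ι → T → ℝ} {ξ : ι → Ω → ℝ}
    (hG : ∀ j, IsIntegrand 𝒜 m P X (G j)) (hGξ : ∀ j, IsIntegral 𝒜 m P X (G j) (ξ j))
    (hGW : ∀ j, W.indicator (G j) = G j) (hh : IsIntegrand 𝒜 m P X h)
    (hhW : Wᶜ.indicator h = h) {E : Set Ω}
    (hE : MeasurableSet[⨆ j, MeasurableSpace.comap (ξ j) (borel ℝ)] E) :
    ∫ ω in E, Complex.exp (stochInt 𝒜 m P X h ω * Complex.I) ∂P =
      P.real E * charFunctional 𝒜 m P X h := by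
  have hH := S.isIntegral_stochInt hh
  set H := stochInt 𝒜 m P X h with hHdef
  have hHm := hH.measurable
  have hcos : ∀ θ : ℝ, ∫ ω in E, Real.cos (H ω + θ) ∂P =
      P.real E * ∫ ω, Real.cos (H ω + θ) ∂P := by
    intro θ
    refine setIntegral_eq_of_integral_exp_mul_eq (fun j => (hGξ j).measurable)
      (Real.measurable_cos.comp (hHm.add_const θ)) (fun ω => Real.abs_cos_le_one _)
      (fun s t => ?_) hE
    have hZ := S.isIntegral_sum s t hGξ
    have hg := S.isIntegrand_sum s t hG
    have hgW : W.indicator (∑ j ∈ s, t j • G j) = ∑ j ∈ s, t j • G j := by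
      rw [Finset.indicator_sum]
      refine Finset.sum_congr rfl fun j _ => ?_
      have : W.indicator (t j • G j) = t j • W.indicator (G j) :=
        Set.indicator_const_smul W (t j) (G j)
      rw [this, hGW]
    have hneg : Wᶜ.indicator ((-1 : ℝ) • h) = (-1 : ℝ) • h := by
      have : Wᶜ.indicator ((-1 : ℝ) • h) = (-1 : ℝ) • Wᶜ.indicator h :=
        Set.indicator_const_smul Wᶜ (-1 : ℝ) h
      rw [this, hhW]
    have e := integral_exp_mul_cos_eq (P := P) hZ.measurable hHm
      (by rw [S.integral_exp_eq_charFunctional hZ, S.integral_exp_eq_charFunctional hH,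
            S.integral_exp_eq_charFunctional (S.isIntegral_add hZ hH)]
          exact S.charFunctional_add hW hg hh hgW hhW)
      (by have h1 := S.isIntegral_smul (-1) hH
          have h2 := S.isIntegral_add hZ h1
          rw [neg_one_smul ℝ H] at h1 h2
          rw [sub_eq_add_neg, S.integral_exp_eq_charFunctional hZ,
            S.integral_exp_eq_charFunctional h1, S.integral_exp_eq_charFunctional h2]
          exact S.charFunctional_add hW hg (S.isIntegrand_smul (-1) hh) hgW hneg) θ
    simpa only [Finset.sum_apply, Pi.smul_apply, smul_eq_mul, Function.comp_def] using e
  -- The phases `0` and `-π / 2` give the real and imaginary parts.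
  have hc := hcos 0
  have hs := hcos (-(Real.pi / 2))
  simp only [add_zero, ← sub_eq_add_neg, Real.cos_sub_pi_div_two] at hc hs
  have hsplit : ∀ ω, Complex.exp (H ω * Complex.I) =
      ((Real.cos (H ω) : ℝ) : ℂ) + ((Real.sin (H ω) : ℝ) : ℂ) * Complex.I := fun ω => by
    rw [Complex.exp_mul_I, Complex.ofReal_cos, Complex.ofReal_sin]
  have hic : Integrable (fun ω => Real.cos (H ω)) P :=
    Integrable.of_bound (Real.measurable_cos.comp hHm).aestronglyMeasurable 1
      (Eventually.of_forall fun ω => Real.abs_cos_le_one _)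
  have his : Integrable (fun ω => Real.sin (H ω)) P :=
    Integrable.of_bound (Real.measurable_sin.comp hHm).aestronglyMeasurable 1
      (Eventually.of_forall fun ω => Real.abs_sin_le_one _)
  rw [charFunctional, ← hHdef]
  simp only [hsplit]
  rw [integral_add hic.ofReal.restrict (his.ofReal.mul_const _).restrict,
    integral_add hic.ofReal (his.ofReal.mul_const _)]
  simp only [integral_mul_const, integral_complex_ofReal]
  rw [hc, hs]
  push_cast
  ring

/-- An event that, for sets `W n` with `m (W n) → 0`, is generated by integrals over `W n` for
each `n` is independent of all stochastic integrals. -/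
theorem setIntegral_exp_stochInt_eq_of_tendsto (S : LevySetting 𝒜 mesh m P X) {W : ℕ → Set T}
    (hW : ∀ n, MeasurableSet (W n)) (hW0 : Tendsto (fun n => m (W n)) atTop (𝓝 0)) {E : Set Ω}
    (hE : ∀ n k, IsIntegrand 𝒜 m P X k → (W n)ᶜ.indicator k = k →
      ∫ ω in E, Complex.exp (stochInt 𝒜 m P X k ω * Complex.I) ∂P =
        P.real E * charFunctional 𝒜 m P X k)
    (hh : IsIntegrand 𝒜 m P X h) :
    ∫ ω in E, Complex.exp (stochInt 𝒜 m P X h ω * Complex.I) ∂P =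
      P.real E * charFunctional 𝒜 m P X h := by
  have hI : ∀ n, IsIntegrand 𝒜 m P X ((W n)ᶜ.indicator h) := fun n =>
    (S.splits (hW n).compl h hh).1
  have hlim : Tendsto (fun n => levyNorm 𝒜 m P X ((W n)ᶜ.indicator h - h)) atTop (𝓝 0) := by
    refine (tendsto_weightedNorm_indicator_of_measure hh.2 hW hW0).congr fun n => ?_
    rw [levyNorm, weightedNorm_sub_comm, Set.indicator_compl, sub_sub_cancel]
  have h1 : Tendsto (fun n =>
      ∫ ω in E, Complex.exp (stochInt 𝒜 m P X ((W n)ᶜ.indicator h) ω * Complex.I) ∂P) atTop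
      (𝓝 (∫ ω in E, Complex.exp (stochInt 𝒜 m P X h ω * Complex.I) ∂P)) := by
    rw [tendsto_iff_edist_tendsto_0]
    refine tendsto_of_tendsto_of_tendsto_of_le_of_le tendsto_const_nhds hlim (fun _ => zero_le)
      (fun n => ?_)
    have h2 := S.isIntegral_stochInt (hI n)
    have h3 := S.isIntegral_stochInt hh
    rw [edist_eq_enorm_sub]
    exact (enorm_setIntegral_exp_sub_le h2.measurable h3.measurable E).trans
      (S.eLpNorm_le (S.isIntegral_sub h2 h3))
  have h4 := (S.tendsto_charFunctional hI hh hlim).const_mul (P.real E : ℂ)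
  refine tendsto_nhds_unique h1 (h4.congr fun n => ?_)
  refine (hE n _ (hI n) ?_).symm
  rw [Set.indicator_indicator, Set.inter_self]

/-- An event generated by stochastic integrals and independent of all stochastic integrals is
independent of itself. -/
theorem measure_eq_zero_or_one (S : LevySetting 𝒜 mesh m P X) {ι : Type*} {G : ι → T → ℝ}
    {ξ : ι → Ω → ℝ} (hG : ∀ j, IsIntegrand 𝒜 m P X (G j))
    (hGξ : ∀ j, IsIntegral 𝒜 m P X (G j) (ξ j)) {E : Set Ω} (hEm : MeasurableSet E)
    (hE : MeasurableSet[⨆ j, MeasurableSpace.comap (ξ j) (borel ℝ)] E)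
    (hind : ∀ k, IsIntegrand 𝒜 m P X k →
      ∫ ω in E, Complex.exp (stochInt 𝒜 m P X k ω * Complex.I) ∂P =
        P.real E * charFunctional 𝒜 m P X k) : P E = 0 ∨ P E = 1 := by
  have hmean : ∫ ω, E.indicator (1 : Ω → ℝ) ω ∂P = P.real E := integral_indicator_one hEm
  have key := setIntegral_eq_of_integral_exp_mul_eq (P := P) (fun j => (hGξ j).measurable)
    (ψ := E.indicator 1) (measurable_one.indicator hEm)
    (fun ω => by by_cases hω : ω ∈ E <;> simp [hω]) (fun s t => by
      have hZ := S.isIntegral_sum s t hGξ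
      have hg := S.isIntegrand_sum s t hG
      have e1 := S.integral_exp_eq_charFunctional hZ
      have e2 := hind _ hg
      have e3 : ∫ ω in E, Complex.exp ((∑ j ∈ s, t j • ξ j) ω * Complex.I) ∂P =
          ∫ ω in E, Complex.exp
            (stochInt 𝒜 m P X (∑ j ∈ s, t j • G j) ω * Complex.I) ∂P := by
        refine integral_congr_ae (ae_restrict_of_ae ?_)
        filter_upwards [S.ae_eq_of_isIntegral hZ (S.isIntegral_stochInt hg)] with ω hω
        rw [hω]
      rw [← e3, ← integral_indicator hEm] at e2
      simp only [Finset.sum_apply, Pi.smul_apply, smul_eq_mul] at e1 e2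
      rw [hmean, e1, mul_comm, ← e2]
      refine integral_congr_ae (Eventually.of_forall fun ω => ?_)
      by_cases hω : ω ∈ E <;> simp [hω]) hE
  rw [hmean, setIntegral_indicator hEm, Set.inter_self] at key
  have h1 : P.real E = P.real E * P.real E := by simpa using key
  have h2 : P.real E = 0 ∨ P.real E = 1 := by
    rcases eq_or_ne (P.real E) 0 with h | h
    · exact Or.inl h
    · exact Or.inr (mul_left_cancel₀ h (by linarith))
  rcases h2 with h | h
  · exact Or.inl ((measureReal_eq_zero_iff).mp h)
  · right
    rw [← ofReal_measureReal (μ := P) (s := E), h, ENNReal.ofReal_one]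

end LevySetting

end ZeroOne

end SetIndexed

theorem mainTheorem5 {T Ω : Type*} [mT : MeasurableSpace T] [MeasurableSpace Ω]
    (P : Measure Ω) [IsProbabilityMeasure P]
    (𝒜 : Set (Set T)) (mesh : ℕ → Set (Set T))
    (h𝒜 : SetIndexed.IsIndexingCollection 𝒜 mesh)
    (hmT : mT = MeasurableSpace.generateFrom 𝒜)
    (d : Set T → Set T → ℝ) (hd : SetIndexed.IsCompatibleMetric 𝒜 mesh d)
    (m : Measure T) (hm : ∀ A ∈ 𝒜, m A < ∞)
    (hdm : SetIndexed.IsCompatibleMetric 𝒜 mesh (fun A A' => (m (A ∆ A')).toReal))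
    (X : Set T → Ω → ℝ) (hX : SetIndexed.IsSetIndexedLevy 𝒜 m P X)
    (f : T → ℝ) (hf : SetIndexed.IsLocallyIntegrable 𝒜 m P X f)
    (Y : Set T → Ω → ℝ)
    (hY : ∀ A ∈ 𝒜, SetIndexed.IsStochasticIntegral 𝒜 m P X (A.indicator f) (Y A))
    (A : Set T) (hA : A ∈ 𝒜)
    (hV : Tendsto (fun ρ : ℝ => m (SetIndexed.vicinity 𝒜 d A ρ)) (𝓝[>] 0) (𝓝 0)) :
    ∀ E : Set Ω, MeasurableSet[SetIndexed.germSigmaAlgebra 𝒜 d Y A] E → P E = 0 ∨ P E = 1 := by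
  intro E hE
  have S : SetIndexed.LevySetting 𝒜 mesh m P X := ⟨h𝒜, hmT, hm, hdm, hX⟩
  have hYI : ∀ B ∈ 𝒜, SetIndexed.IsIntegral 𝒜 m P X (B.indicator f) (Y B) := fun B hB =>
    SetIndexed.IsStochasticIntegral.isIntegral (hf.1.indicator (S.measurableSet B hB)) (hY B hB)
  have hfI : ∀ B ∈ 𝒜, SetIndexed.IsIntegrand 𝒜 m P X (B.indicator f) := fun B hB =>
    (hYI B hB).isIntegrand ((SetIndexed.levyNorm_le_two_mul_normLX _).trans_lt
      (ENNReal.mul_lt_top ENNReal.ofNat_lt_top (hf.2 B hB)))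
  let ι : ℝ → Type _ := fun ρ => {A' : Set T // A' ∈ 𝒜 ∧ 0 < d A A' ∧ d A A' < ρ}
  let G : ∀ ρ, ι ρ → T → ℝ := fun ρ j => A.indicator f - j.1.indicator f
  let ξ : ∀ ρ, ι ρ → Ω → ℝ := fun ρ j => Y A - Y j.1
  have hG : ∀ ρ j, SetIndexed.IsIntegrand 𝒜 m P X (G ρ j) := fun ρ j =>
    S.isIntegrand_sub (hfI A hA) (hfI j.1 j.2.1)
  have hGξ : ∀ ρ j, SetIndexed.IsIntegral 𝒜 m P X (G ρ j) (ξ ρ j) := fun ρ j =>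
    S.isIntegral_sub (hYI A hA) (hYI j.1 j.2.1)
  have hloc : ∀ ρ, SetIndexed.localSigmaAlgebra 𝒜 d Y A ρ =
      ⨆ j : ι ρ, MeasurableSpace.comap (ξ ρ j) (borel ℝ) := fun ρ => iSup_subtype'
  have hEρ : ∀ ρ : ℝ, 0 < ρ →
      MeasurableSet[⨆ j : ι ρ, MeasurableSpace.comap (ξ ρ j) (borel ℝ)] E := by
    intro ρ hρ
    rw [← hloc]
    exact (iInf₂_le (f := fun (ρ : ℝ) (_ : ρ ∈ Set.Ioi (0 : ℝ)) =>
      SetIndexed.localSigmaAlgebra 𝒜 d Y A ρ) ρ hρ) E hE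
  have hEm : MeasurableSet E := by
    have hle : (⨆ j : ι 1, MeasurableSpace.comap (ξ 1 j) (borel ℝ)) ≤ ‹MeasurableSpace Ω› := by
      refine iSup_le fun j => ?_
      rw [← BorelSpace.measurable_eq (α := ℝ)]
      exact (hGξ 1 j).measurable.comap_le
    exact hle _ (hEρ 1 one_pos)
  -- The vicinity need not be measurable, hence the measurable hull.
  let W : ℕ → Set T := fun n => toMeasurable m (SetIndexed.vicinity 𝒜 d A (1 / (n + 1)))
  have hWm : ∀ n, MeasurableSet (W n) := fun n => measurableSet_toMeasurable _ _
  have hW0 : Tendsto (fun n => m (W n)) atTop (𝓝 0) := by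
    simp only [W, measure_toMeasurable]
    refine hV.comp (tendsto_nhdsWithin_iff.mpr ⟨tendsto_one_div_add_atTop_nhds_zero_nat, ?_⟩)
    exact Eventually.of_forall fun n => Set.mem_Ioi.mpr (by positivity)
  have hGW : ∀ (n : ℕ) (j : ι (1 / (n + 1))), (W n).indicator (G _ j) = G _ j := by
    intro n j
    refine Set.indicator_eq_self.mpr fun t ht => ?_
    by_contra htW
    have htV : t ∉ A ∆ j.1 := fun h => htW (subset_toMeasurable _ _
      (Set.mem_biUnion (show j.1 ∈ {A' | A' ∈ 𝒜 ∧ d A A' < 1 / (n + 1)} from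
        ⟨j.2.1, j.2.2.2⟩) h))
    refine ht ?_
    simp only [Set.mem_symmDiff, not_or, not_and_not_right] at htV
    by_cases htA : t ∈ A
    · simp [G, htA, htV.1 htA]
    · have htj : t ∉ j.1 := fun h => htA (htV.2 h)
      simp [G, htA, htj]
  refine S.measure_eq_zero_or_one (hG 1) (hGξ 1) hEm (hEρ 1 one_pos) fun k hk =>
    S.setIntegral_exp_stochInt_eq_of_tendsto hWm hW0 (fun n k hk hkW => ?_) hk
  exact S.setIntegral_exp_stochInt_eq (hWm n) (hG _) (hGξ _) (hGW n) hk hkW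
    (hEρ _ (by positivity))
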